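/- Let $\Omega\subset\mathbb R^n$ be open, $p\in[1,\infty)$, and $(X,d,z_0)$ a pointed complete metric space. Let $\mathrm{Lip}_{z_0}(X)$ be the Banach space of real Lipschitz functions on $X$ vanishing at $z_0$, normed by the Lipschitz constant $\mathrm{Lip}(\varphi)$. $L^p(\Omega;X)$ is the set of Lebesgue measurable, essentially separably valued $f:\Omega\to X$ with $d(f(\cdot),z_0)\in L^p(\Omega)$; and $f\in L^1_{\rm loc}(\Omega;X)$ means $f\in L^1(K;X)$ for every compact $K\subset\Omega$. Reshetnyak's space $W^{1,p}(\Omega;X)$ consists of those $f\in L^p(\Omega;X)$ such that $\varphi\circ f\in W^{1,p}(\Omega)$ for every $\varphi\in\mathrm{Lip}_{z_0}(X)$, and there is $g\in L^p(\Omega)$ with $|\nabla(\varphi\circ f)|\le \mathrm{Lip}(\varphi)\,g$ a.e. in $\Omega$ for every $\varphi\in\mathrm{Lip}_{z_0}(X)$. For $f\in L^1_{\rm loc}(\Omega;X)$, a map $\partial_jf:\Omega\to(\mathrm{Lip}_{z_0}(X))^*$ is a *$j$-th partial weak weak\* derivative* of $f$ if for every $\varphi\in\mathrm{Lip}_{z_0}(X)$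 the function $x\mapsto\langle\varphi,\partial_jf(x)\rangle$ is in $L^1_{\rm loc}(\Omega)$ and $\int_\Omega \frac{\partial\eta}{\partial x_j}\,\varphi\circ f\,dx=-\int_\Omega\eta\,\langle\varphi,\partial_jf(x)\rangle\,dx$ for all $\eta\in C_0^\infty(\Omega)$. A *Banach limit* is here a continuous linear functional on $\ell^\infty$ that equals the limit on convergent sequences and is nonnegative on nonnegative sequences. Given a Banach limit $\Phi$ and a sequence $\delta_k>0$, $\delta_k\to0$, the *canonical derivative* of $h:\Omega\to X$ is $$\langle\varphi,\partial_j^\circ h(x)\rangle=\Phi\text{-}\lim_{k\to\infty}\frac{\varphi(h(x+\delta_ke_j))-\varphi(h(x))}{\delta_k},\qquad \varphi\in\mathrm{Lip}_{z_0}(X),$$ at every $x\in\Omega$ for which $$(\ast)\quad \exists\, C>0\ \ \forall\varphi\in\mathrm{Lip}_{z_0}(X):\quad \limsup_{t\to0}\frac{|\varphi(h(x+te_j))-\varphi(h(x))|}{|t|}\le C\,\mathrm{Lip}(\varphi),$$ and $\partial_j^\circ h(x)=0$ at all other $x$. **Theorem.** Let $f:\Omega\to X$. 1. $f\in W^{1,p}(\Omega;X)$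 if and only if $f\in L^p(\Omega;X)$ and for each $j=1,\dots,n$ there is a $j$-th partial weak weak\* derivative $\partial_jf:\Omega\to(\mathrm{Lip}_{z_0}(X))^*$ of $f$ such that $x\mapsto\|\partial_jf(x)\|_{(\mathrm{Lip}_{z_0}(X))^*}$ belongs to $L^p(\Omega)$ (in particular is measurable). 2. Let $f\in W^{1,p}(\Omega;X)$ and $j\in\{1,\dots,n\}$. Then $f$ has a representative $\widetilde f$ (i.e. $\widetilde f=f$ a.e. in $\Omega$) that is absolutely continuous on compact line segments contained in $\Omega\cap l$ for almost every line $l$ parallel to $e_j$. For every such $\widetilde f$, condition $(\ast)$ for $h=\widetilde f$ holds at almost every $x\in\Omega$, and for every choice of the Banach limit $\Phi$ and of the sequence $(\delta_k)$ the canonical derivative $\partial_j^\circ\widetilde f$ is a $j$-th partial weak weak\* derivative of $f$ with $\|\partial_j^\circ\widetilde f(\cdot)\|_{(\mathrm{Lip}_{z_0}(X))^*}\in L^p(\Omega)$. -/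

import Mathlib

open Set Filter Topology MeasureTheory
open scoped ENNReal NNReal

noncomputable section

/-! ### The Banach space of Lipschitz functions vanishing at the base point -/

/-- The real Lipschitz functions on `X` vanishing at `z₀`, as a subspace of `X → ℝ`. -/
def lipZeroSubmodule {X : Type*} [MetricSpace X] (z₀ : X) : Submodule ℝ (X → ℝ) where
  carrier := {φ | (∃ K : ℝ≥0, LipschitzWith K φ) ∧ φ z₀ = 0}
  add_mem' := by
    rintro φ ψ ⟨⟨K, hK⟩, h0⟩ ⟨⟨L, hL⟩, h1⟩
    exact ⟨⟨K + L, hK.add hL⟩, by simp [h0, h1]⟩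
  zero_mem' := ⟨⟨0, LipschitzWith.const 0⟩, rfl⟩
  smul_mem' := by
    rintro c φ ⟨⟨K, hK⟩, h0⟩
    refine ⟨⟨‖c‖₊ * K, LipschitzWith.of_dist_le_mul fun x y => ?_⟩, by simp [h0]⟩
    have h := hK.dist_le_mul x y
    rw [Real.dist_eq] at h ⊢
    have h2 : |(c • φ) x - (c • φ) y| = |c| * |φ x - φ y| := by
      rw [← abs_mul]; congr 1; simp [mul_sub]
    rw [h2]
    push_cast
    rw [Real.norm_eq_abs, mul_assoc]
    exact mul_le_mul_of_nonneg_left h (abs_nonneg c)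

/-- `Lip_{z₀}(X)`. It is a type of its own, so that its only topology is the one of the Lipschitz
norm (and not the topology of pointwise convergence). -/
def LipZero {X : Type*} [MetricSpace X] (z₀ : X) : Type _ := ↥(lipZeroSubmodule z₀)

namespace LipZero

variable {X : Type*} [MetricSpace X] {z₀ : X}

instance : AddCommGroup (LipZero z₀) := inferInstanceAs (AddCommGroup ↥(lipZeroSubmodule z₀))

instance : Module ℝ (LipZero z₀) := inferInstanceAs (Module ℝ ↥(lipZeroSubmodule z₀))

instance : CoeFun (LipZero z₀) (fun _ => X → ℝ) := ⟨fun φ => φ.1⟩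

/-- `Lip(φ) = sup { |φ x - φ y| / d(x, y) : x ≠ y }` (and `0` on a one-point space). -/
instance : Norm (LipZero z₀) :=
  ⟨fun φ => sSup {r : ℝ | ∃ x y : X, x ≠ y ∧ r = |φ x - φ y| / dist x y}⟩

theorem norm_def (φ : LipZero z₀) :
    ‖φ‖ = sSup {r : ℝ | ∃ x y : X, x ≠ y ∧ r = |φ x - φ y| / dist x y} := rfl

theorem add_apply (φ ψ : LipZero z₀) (x : X) : (φ + ψ) x = φ x + ψ x := rfl

theorem smul_apply (c : ℝ) (φ : LipZero z₀) (x : X) : (c • φ) x = c * φ x := rfl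

theorem zero_apply (x : X) : (0 : LipZero z₀) x = 0 := rfl

theorem ext {φ ψ : LipZero z₀} (h : ∀ x, φ x = ψ x) : φ = ψ := Subtype.ext (funext h)

theorem apply_base (φ : LipZero z₀) : φ z₀ = 0 := φ.2.2

theorem norm_nonneg' (φ : LipZero z₀) : 0 ≤ ‖φ‖ := by
  refine Real.sSup_nonneg ?_
  rintro r ⟨x, y, -, rfl⟩
  positivity

theorem abs_sub_le (φ : LipZero z₀) (x y : X) : |φ x - φ y| ≤ ‖φ‖ * dist x y := by
  rcases eq_or_ne x y with rfl | hxy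
  · simp
  · obtain ⟨K, hK⟩ := φ.2.1
    have hd : 0 < dist x y := dist_pos.2 hxy
    rw [← div_le_iff₀ hd]
    refine le_csSup ⟨K, ?_⟩ ⟨x, y, hxy, rfl⟩
    rintro r ⟨a, b, hab, rfl⟩
    rw [div_le_iff₀ (dist_pos.2 hab)]
    have := hK.dist_le_mul a b
    rwa [Real.dist_eq] at this

theorem norm_le {φ : LipZero z₀} {C : ℝ} (hC : 0 ≤ C)
    (h : ∀ x y, |φ x - φ y| ≤ C * dist x y) : ‖φ‖ ≤ C := by
  refine Real.sSup_le ?_ hC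
  rintro r ⟨x, y, hxy, rfl⟩
  rw [div_le_iff₀ (dist_pos.2 hxy)]
  exact h x y

theorem norm_smul_le' (c : ℝ) (φ : LipZero z₀) : ‖c • φ‖ ≤ |c| * ‖φ‖ := by
  refine norm_le (mul_nonneg (abs_nonneg c) (norm_nonneg' φ)) fun x y => ?_
  rw [smul_apply, smul_apply, ← mul_sub, abs_mul, mul_assoc]
  exact mul_le_mul_of_nonneg_left (abs_sub_le φ x y) (abs_nonneg c)

theorem core : NormedSpace.Core ℝ (LipZero z₀) where
  norm_nonneg := norm_nonneg'
  norm_smul c φ := by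
    rw [Real.norm_eq_abs]
    refine le_antisymm (norm_smul_le' c φ) ?_
    rcases eq_or_ne c 0 with rfl | hc
    · simpa using norm_nonneg' _
    · have h := norm_smul_le' c⁻¹ (c • φ)
      rw [smul_smul, inv_mul_cancel₀ hc, one_smul, abs_inv] at h
      have hc' : 0 < |c| := abs_pos.2 hc
      calc |c| * ‖φ‖ ≤ |c| * (|c|⁻¹ * ‖c • φ‖) := mul_le_mul_of_nonneg_left h hc'.le
        _ = ‖c • φ‖ := by rw [← mul_assoc, mul_inv_cancel₀ hc'.ne', one_mul]
  norm_triangle φ ψ := by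
    refine norm_le (add_nonneg (norm_nonneg' φ) (norm_nonneg' ψ)) fun x y => ?_
    rw [add_apply, add_apply, add_mul]
    calc |φ x + ψ x - (φ y + ψ y)| = |(φ x - φ y) + (ψ x - ψ y)| := by congr 1; ring
      _ ≤ |φ x - φ y| + |ψ x - ψ y| := abs_add_le _ _
      _ ≤ _ := add_le_add (abs_sub_le φ x y) (abs_sub_le ψ x y)
  norm_eq_zero_iff φ := by
    constructor
    · intro h
      refine ext fun x => ?_
      have h1 := abs_sub_le φ x z₀
      rw [h, zero_mul, apply_base, sub_zero] at h1
      exact abs_nonpos_iff.1 h1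
    · rintro rfl
      refine le_antisymm (norm_le le_rfl fun x y => ?_) (norm_nonneg' _)
      simp [zero_apply]

instance : NormedAddCommGroup (LipZero z₀) := NormedAddCommGroup.ofCore core

instance : NormedSpace ℝ (LipZero z₀) := NormedSpace.ofCore core

/-- The function `y ↦ d(y, a) - d(z₀, a)`. -/
def distFun (z₀ a : X) : LipZero z₀ :=
  ⟨fun y => dist y a - dist z₀ a,
    ⟨1, LipschitzWith.of_dist_le_mul fun x y => by
      rw [Real.dist_eq, sub_sub_sub_cancel_right]
      simpa using abs_dist_sub_le x y a⟩, by simp⟩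

end LipZero

/-! ### Classical Sobolev functions -/

section Sobolev

variable {n : ℕ}

/-- `u ∈ L¹_loc(Ω)`: integrable on every compact subset of `Ω`. -/
def LocL1 (Ω : Set (EuclideanSpace ℝ (Fin n))) (u : EuclideanSpace ℝ (Fin n) → ℝ) : Prop :=
  ∀ K : Set (EuclideanSpace ℝ (Fin n)), IsCompact K → K ⊆ Ω → IntegrableOn u K volume

/-- `η ∈ C₀^∞(Ω)`. -/
def IsTestFunction (Ω : Set (EuclideanSpace ℝ (Fin n))) (η : EuclideanSpace ℝ (Fin n) → ℝ) :
    Prop :=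
  ContDiff ℝ (⊤ : ℕ∞) η ∧ HasCompactSupport η ∧ tsupport η ⊆ Ω

/-- `v` is a weak `j`-th partial derivative of `u` in `Ω`. -/
def IsWeakPartialDeriv (Ω : Set (EuclideanSpace ℝ (Fin n))) (j : Fin n)
    (u v : EuclideanSpace ℝ (Fin n) → ℝ) : Prop :=
  LocL1 Ω u ∧ LocL1 Ω v ∧
    ∀ η : EuclideanSpace ℝ (Fin n) → ℝ, IsTestFunction Ω η →
      ∫ x in Ω, fderiv ℝ η x (EuclideanSpace.single j (1 : ℝ)) * u x = - ∫ x in Ω, η x * v x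

/-- `u ∈ W^{1,p}(Ω)`. -/
def MemW1p (Ω : Set (EuclideanSpace ℝ (Fin n))) (p : ℝ≥0∞)
    (u : EuclideanSpace ℝ (Fin n) → ℝ) : Prop :=
  MemLp u p (volume.restrict Ω) ∧
    ∀ j : Fin n, ∃ v : EuclideanSpace ℝ (Fin n) → ℝ,
      IsWeakPartialDeriv Ω j u v ∧ MemLp v p (volume.restrict Ω)

end Sobolev

/-! ### Metric valued Sobolev maps and weak weak* derivatives

A map `Ω → X` is given by a function on all of `ℝⁿ`, of which only the values on the open set `Ω`
matter. -/

section MetricValued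

variable {n : ℕ} {X : Type*} [MetricSpace X]

/-- `f ∈ L^p(S; X)`. A map into a metric space is Lebesgue measurable and essentially separably
valued on `S` if and only if it is `AEStronglyMeasurable` for Lebesgue measure on `S`. -/
def MemLpMetric (S : Set (EuclideanSpace ℝ (Fin n))) (z₀ : X) (p : ℝ≥0∞)
    (f : EuclideanSpace ℝ (Fin n) → X) : Prop :=
  AEStronglyMeasurable f (volume.restrict S) ∧
    MemLp (fun x => dist (f x) z₀) p (volume.restrict S)

/-- `f ∈ L¹_loc(Ω; X)`. -/
def LocL1Metric (Ω : Set (EuclideanSpace ℝ (Fin n))) (z₀ : X)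
    (f : EuclideanSpace ℝ (Fin n) → X) : Prop :=
  ∀ K : Set (EuclideanSpace ℝ (Fin n)), IsCompact K → K ⊆ Ω → MemLpMetric K z₀ 1 f

/-- `g ∈ L^p(Ω)` is a Reshetnyak upper gradient of `f`: for every `φ ∈ Lip_{z₀}(X)` the weak
gradient `G` of `φ ∘ f` satisfies `|G| ≤ Lip(φ) g` almost everywhere in `Ω`. -/
def IsReshetnyakUpperGradient (Ω : Set (EuclideanSpace ℝ (Fin n))) (z₀ : X) (p : ℝ≥0∞)
    (f : EuclideanSpace ℝ (Fin n) → X) (g : EuclideanSpace ℝ (Fin n) → ℝ) : Prop :=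
  MemLp g p (volume.restrict Ω) ∧
    ∀ (φ : LipZero z₀) (G : EuclideanSpace ℝ (Fin n) → EuclideanSpace ℝ (Fin n)),
      (∀ j : Fin n, IsWeakPartialDeriv Ω j (fun x => φ (f x)) (fun x => G x j)) →
        ∀ᵐ x ∂(volume.restrict Ω), ‖G x‖ ≤ ‖φ‖ * g x

/-- Reshetnyak's space `W^{1,p}(Ω; X)`. -/
def MemW1pMetric (Ω : Set (EuclideanSpace ℝ (Fin n))) (z₀ : X) (p : ℝ≥0∞)
    (f : EuclideanSpace ℝ (Fin n) → X) : Prop :=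
  MemLpMetric Ω z₀ p f ∧
    (∀ φ : LipZero z₀, MemW1p Ω p (fun x => φ (f x))) ∧
      ∃ g : EuclideanSpace ℝ (Fin n) → ℝ, IsReshetnyakUpperGradient Ω z₀ p f g

/-- `D : Ω → Lip_{z₀}(X)*` is a `j`-th partial weak weak* derivative of `f`. -/
def IsWeakWeakStarDeriv (Ω : Set (EuclideanSpace ℝ (Fin n))) (z₀ : X) (j : Fin n)
    (f : EuclideanSpace ℝ (Fin n) → X)
    (D : EuclideanSpace ℝ (Fin n) → (LipZero z₀ →L[ℝ] ℝ)) : Prop :=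
  LocL1Metric Ω z₀ f ∧
    ∀ φ : LipZero z₀, IsWeakPartialDeriv Ω j (fun x => φ (f x)) (fun x => D x φ)

/-- `f` is absolutely continuous on almost every compact line segment in `Ω` parallel to `ν`:
almost every point of `Ω` lies on a line parallel to `ν` such that `f` is absolutely continuous on
every compact segment of that line contained in `Ω`. -/
def IsACOnLines (Ω : Set (EuclideanSpace ℝ (Fin n))) (ν : EuclideanSpace ℝ (Fin n))
    (f : EuclideanSpace ℝ (Fin n) → X) : Prop :=
  ∀ᵐ x ∂(volume.restrict Ω), ∀ a b : ℝ, a ≤ b → (∀ t ∈ Icc a b, x + t • ν ∈ Ω) →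
    AbsolutelyContinuousOnInterval (fun t : ℝ => f (x + t • ν)) a b

/-! ### The canonical derivative -/

/-- A Banach limit: a continuous linear functional on `ℓ^∞` that extends the limit and is
nonnegative on nonnegative sequences. -/
structure IsBanachLimit (L : lp (fun _ : ℕ => ℝ) ∞ →L[ℝ] ℝ) : Prop where
  eq_lim : ∀ (a : lp (fun _ : ℕ => ℝ) ∞) (l : ℝ), Tendsto (fun k => a k) atTop (𝓝 l) → L a = l
  nonneg : ∀ a : lp (fun _ : ℕ => ℝ) ∞, (∀ k, 0 ≤ a k) → 0 ≤ L a

/-- A sequence of positive step sizes tending to zero. -/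
structure IsStepSequence (δ : ℕ → ℝ) : Prop where
  pos : ∀ k, 0 < δ k
  tendsto : Tendsto δ atTop (𝓝 0)

/-- There is `C > 0` such that for all `φ ∈ Lip_{z₀}(X)`
`limsup_{h → 0} |φ(f(x + hν)) - φ(f(x))| / |h| ≤ C Lip(φ)`. -/
def HasBoundedQuotients (z₀ : X) (ν : EuclideanSpace ℝ (Fin n))
    (f : EuclideanSpace ℝ (Fin n) → X) (x : EuclideanSpace ℝ (Fin n)) : Prop :=
  ∃ C : ℝ, 0 < C ∧ ∀ φ : LipZero z₀,
    limsup (fun h : ℝ => ENNReal.ofReal (|φ (f (x + h • ν)) - φ (f x)| / |h|)) (𝓝[≠] 0)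
      ≤ ENNReal.ofReal (C * ‖φ‖)

/-- The `k`-th difference quotient of `φ ∘ f` at `x` in direction `ν`. -/
def diffQuot {z₀ : X} (δ : ℕ → ℝ) (ν : EuclideanSpace ℝ (Fin n))
    (f : EuclideanSpace ℝ (Fin n) → X) (x : EuclideanSpace ℝ (Fin n)) (φ : LipZero z₀) (k : ℕ) :
    ℝ :=
  (φ (f (x + δ k • ν)) - φ (f x)) / δ k

theorem HasBoundedQuotients.exists_bound {z₀ : X} {ν : EuclideanSpace ℝ (Fin n)}
    {f : EuclideanSpace ℝ (Fin n) → X} {x : EuclideanSpace ℝ (Fin n)}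
    (h : HasBoundedQuotients z₀ ν f x) {δ : ℕ → ℝ} (hδ : IsStepSequence δ) :
    ∃ B : ℝ, ∀ (φ : LipZero z₀) (k : ℕ), |diffQuot δ ν f x φ k| ≤ B * ‖φ‖ := by
  obtain ⟨C, -, hC⟩ := h
  have h1 := hC (LipZero.distFun z₀ (f x))
  set M : ℝ := C * ‖LipZero.distFun z₀ (f x)‖ with hM
  have h2 : limsup (fun h : ℝ => ENNReal.ofReal (|LipZero.distFun z₀ (f x) (f (x + h • ν)) -
      LipZero.distFun z₀ (f x) (f x)| / |h|)) (𝓝[≠] 0) < ENNReal.ofReal M + 1 :=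
    lt_of_le_of_lt h1 (ENNReal.lt_add_right ENNReal.ofReal_ne_top one_ne_zero)
  have h3 := eventually_lt_of_limsup_lt h2
  have hδ' : Tendsto δ atTop (𝓝[≠] 0) :=
    tendsto_nhdsWithin_iff.2 ⟨hδ.tendsto, Eventually.of_forall fun k => (hδ.pos k).ne'⟩
  have h4 := hδ'.eventually h3
  have key : BddAbove (range fun k => dist (f (x + δ k • ν)) (f x) / δ k) := by
    refine Filter.IsBoundedUnder.bddAbove_range (f := fun k => dist (f (x + δ k • ν)) (f x) / δ k)
      (isBoundedUnder_of_eventually_le (a := |M| + 1) ?_)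
    filter_upwards [h4] with k hk
    have e : |LipZero.distFun z₀ (f x) (f (x + δ k • ν)) - LipZero.distFun z₀ (f x) (f x)| / |δ k|
        = dist (f (x + δ k • ν)) (f x) / δ k := by
      simp only [LipZero.distFun]
      rw [sub_sub_sub_cancel_right, dist_self, sub_zero, abs_of_nonneg dist_nonneg,
        abs_of_pos (hδ.pos k)]
    rw [e] at hk
    have h5 : ENNReal.ofReal (dist (f (x + δ k • ν)) (f x) / δ k) ≤ ENNReal.ofReal (|M| + 1) := by
      refine hk.le.trans ?_
      rw [ENNReal.ofReal_add (abs_nonneg M) zero_le_one, ENNReal.ofReal_one]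
      gcongr
      exact le_abs_self M
    exact (ENNReal.ofReal_le_ofReal_iff (by positivity)).1 h5
  obtain ⟨B, hB⟩ := key
  refine ⟨B, fun φ k => ?_⟩
  have hk : dist (f (x + δ k • ν)) (f x) / δ k ≤ B := hB ⟨k, rfl⟩
  rw [diffQuot, abs_div, abs_of_pos (hδ.pos k)]
  calc |φ (f (x + δ k • ν)) - φ (f x)| / δ k
      ≤ ‖φ‖ * dist (f (x + δ k • ν)) (f x) / δ k := by
        have := hδ.pos k
        gcongr
        exact LipZero.abs_sub_le φ _ _
    _ = dist (f (x + δ k • ν)) (f x) / δ k * ‖φ‖ := by ring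
    _ ≤ B * ‖φ‖ := mul_le_mul_of_nonneg_right hk (norm_nonneg φ)

theorem HasBoundedQuotients.memlp {z₀ : X} {ν : EuclideanSpace ℝ (Fin n)}
    {f : EuclideanSpace ℝ (Fin n) → X} {x : EuclideanSpace ℝ (Fin n)}
    (h : HasBoundedQuotients z₀ ν f x) {δ : ℕ → ℝ} (hδ : IsStepSequence δ) (φ : LipZero z₀) :
    Memℓp (diffQuot δ ν f x φ) ∞ := by
  obtain ⟨B, hB⟩ := h.exists_bound hδ
  refine memℓp_infty ⟨B * ‖φ‖, ?_⟩
  rintro _ ⟨k, rfl⟩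
  exact hB φ k

open Classical in
/-- The canonical derivative `∂°_ν f(x) ∈ Lip_{z₀}(X)*` built from the Banach limit `L` and the step
sequence `δ`: `⟨φ, ∂°_ν f(x)⟩ = L-lim_k (φ(f(x + δ_k ν)) - φ(f(x))) / δ_k` at the points `x` where
`HasBoundedQuotients` holds, and `0` at the other points. -/
def canonicalDeriv (z₀ : X) (L : lp (fun _ : ℕ => ℝ) ∞ →L[ℝ] ℝ) {δ : ℕ → ℝ}
    (hδ : IsStepSequence δ) (ν : EuclideanSpace ℝ (Fin n)) (f : EuclideanSpace ℝ (Fin n) → X)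
    (x : EuclideanSpace ℝ (Fin n)) : LipZero z₀ →L[ℝ] ℝ :=
  if h : HasBoundedQuotients z₀ ν f x then
    LinearMap.mkContinuousOfExistsBound
      { toFun := fun φ => L ⟨diffQuot δ ν f x φ, h.memlp hδ φ⟩
        map_add' := fun φ ψ => by
          rw [← map_add]
          congr 1
          ext k
          simp only [diffQuot, LipZero.add_apply, lp.coeFn_add, Pi.add_apply]
          ring
        map_smul' := fun c φ => by
          rw [RingHom.id_apply, ← map_smul]
          congr 1
          ext k
          simp only [diffQuot, LipZero.smul_apply, lp.coeFn_smul, Pi.smul_apply, smul_eq_mul]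
          ring }
      (by
        obtain ⟨B, hB⟩ := h.exists_bound hδ
        refine ⟨‖L‖ * |B|, fun φ => ?_⟩
        refine (L.le_opNorm _).trans ?_
        rw [mul_assoc]
        refine mul_le_mul_of_nonneg_left ?_ (norm_nonneg L)
        refine lp.norm_le_of_forall_le (by positivity) fun k => ?_
        exact (hB φ k).trans (mul_le_mul_of_nonneg_right (le_abs_self B) (norm_nonneg φ)))
  else 0

end MetricValued

end

/-! ### Almost every line in a given direction -/

section Lines

/-! The bridge between weak derivatives and lines is that a weak partial derivative `v` of `u`
satisfies `u (x + h • e) - u x = ∫ r in 0..h, v (x + r • e)` for almost every `x` and almost every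
`h`. This is obtained by testing against translates of a test function and applying Fubini
(`integral_mul_increment_eq`, `IsWeakPartialDeriv.ae_increment_eq`). "Almost every line" is
expressed throughout by "almost every point", through the map `(x, r) ↦ x + r • e`, so no splitting
of the space into a line and a hyperplane is needed.

Let `f` be a Reshetnyak map. Its essential range lies in the closure of a sequence `z k`, and the
1-Lipschitz functions `distFun z₀ (z k)` recover distances there. Their `j`-th weak derivatives are
dominated by the upper gradient, so the supremum `m` of their absolute values is in `L^p`
(`MemW1pMetric.exists_speed`). Integrating along lines gives `dist (f (x + s • e)) (f (x + t • e)) ≤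
|∫ r in s..t, m (x + r • e)|` for points of a set of full measure (`exists_ae_dist_le_integral`). By
completeness `f` extends from that set to a curve on almost every line with the same bound, which is
the absolutely continuous representative (`exists_ae_eq_isACOnLines`).

For any such representative, continuity makes the increment bound and, for each `φ`, the increment
formula hold for every step `h`. Lebesgue differentiation on lines then bounds the quotients
uniformly in `φ`, and for each fixed `φ` makes them converge almost everywhere to the weak
derivative of `φ ∘ f`. The exceptional set depends on `φ`, which is harmless because the definition
of a weak weak* derivative tests one `φ` at a time; the Banach limit supplies linearity at each
single point. The norm of the canonical derivative is almost everywhere equal to `m`, which settles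
its measurability and integrability (`canonicalDeriv_properties`).

Conversely, weak derivatives are unique, so the components of the gradient of `φ ∘ f` are `D j x φ`,
and the sum of the norms `‖D j x‖` is an upper gradient. -/

theorem intervalIntegral_line_eq {E : Type*} [AddCommGroup E] [Module ℝ E] (F : E → ℝ)
    (e x : E) (h : ℝ) :
    ∫ r in (0 : ℝ)..h, F (x + r • e) = h * ∫ s in (0 : ℝ)..1, F (x + (h * s) • e) := by
  rw [intervalIntegral.mul_integral_comp_mul_left (f := fun r => F (x + r • e))]
  simp

variable {E : Type*} [NormedAddCommGroup E] [NormedSpace ℝ E] [MeasurableSpace E] [BorelSpace E]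
  [FiniteDimensional ℝ E] {μ : Measure E} [μ.IsAddHaarMeasure]

theorem quasiMeasurePreserving_add_smul (e : E) (ν : Measure ℝ) [SFinite ν] :
    Measure.QuasiMeasurePreserving (fun z : E × ℝ => z.1 + z.2 • e) (μ.prod ν) μ :=
  QuasiMeasurePreserving.prod_of_left (by fun_prop)
    (Eventually.of_forall fun r => (measurePreserving_add_right μ (r • e)).quasiMeasurePreserving)

theorem ae_ae_line_of_ae {P : E → Prop} (h : ∀ᵐ x ∂μ, P x) (e : E) :
    ∀ᵐ x ∂μ, ∀ᵐ r : ℝ, P (x + r • e) :=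
  Measure.ae_ae_of_ae_prod ((quasiMeasurePreserving_add_smul e volume).ae h)

/-- Exchanging the two quantifiers yields a single `r` such that `P (x + r • e)` holds for almost
every `x`; translation invariance removes the shift. The exchange is what requires measurability. -/
theorem ae_of_ae_ae_line {P : E → Prop} (hP : MeasurableSet {x | P x}) {e : E}
    (h : ∀ᵐ x ∂μ, ∀ᵐ r : ℝ, P (x + r • e)) : ∀ᵐ x ∂μ, P x := by
  have hm : MeasurableSet {z : E × ℝ | P (z.1 + z.2 • e)} :=
    hP.preimage (f := fun z : E × ℝ => z.1 + z.2 • e) (by fun_prop)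
  obtain ⟨r, hr⟩ := ((Measure.ae_ae_comm (p := fun x r => P (x + r • e)) hm).1 h).exists
  have h2 := (measurePreserving_add_right μ (-(r • e))).quasiMeasurePreserving.ae hr
  simpa using h2

theorem MeasureTheory.Integrable.comp_add_smul {F : E → ℝ} (hF : Integrable F μ) (e : E)
    (ν : Measure ℝ) [IsFiniteMeasure ν] :
    Integrable (fun z : E × ℝ => F (z.1 + z.2 • e)) (μ.prod ν) := by
  have hm : AEStronglyMeasurable (fun z : E × ℝ => F (z.1 + z.2 • e)) (μ.prod ν) :=
    hF.1.comp_quasiMeasurePreserving (quasiMeasurePreserving_add_smul e ν)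
  rw [integrable_prod_iff' hm]
  refine ⟨Eventually.of_forall fun r => hF.comp_add_right (r • e), ?_⟩
  simp_rw [integral_add_right_eq_self (fun x => ‖F x‖)]
  exact integrable_const _

theorem MeasureTheory.Integrable.ae_locallyIntegrable_line {F : E → ℝ} (hF : Integrable F μ)
    (e : E) : ∀ᵐ x ∂μ, LocallyIntegrable (fun r : ℝ => F (x + r • e)) := by
  have h : ∀ᵐ x ∂μ, ∀ N : ℕ, IntegrableOn (fun r : ℝ => F (x + r • e)) (Icc (-N) N) :=
    ae_all_iff.2 fun N =>
      (hF.comp_add_smul e (volume.restrict (Icc (-(N : ℝ)) N))).prod_right_ae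
  filter_upwards [h] with x hx
  refine (locallyIntegrable_iff).2 fun K hK => ?_
  obtain ⟨R, hR⟩ := hK.isBounded.subset_closedBall 0
  obtain ⟨N, hN⟩ := exists_nat_ge R
  refine (hx N).mono_set fun y hy => ?_
  have := hR hy
  rw [Real.closedBall_eq_Icc] at this
  exact ⟨by linarith [this.1], by linarith [this.2]⟩

theorem MeasureTheory.StronglyMeasurable.intervalIntegral_line {F : E → ℝ}
    (hF : StronglyMeasurable F) (e : E) :
    StronglyMeasurable (fun z : E × ℝ => ∫ r in (0 : ℝ)..z.2, F (z.1 + r • e)) := by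
  -- Rescaling to the fixed interval `[0, 1]` moves `h` into the integrand, so joint measurability
  -- becomes that of a parameter integral.
  simp_rw [intervalIntegral_line_eq F e, intervalIntegral.integral_of_le zero_le_one]
  refine continuous_snd.stronglyMeasurable.mul ?_
  exact StronglyMeasurable.integral_prod_right
    (f := fun (z : E × ℝ) (s : ℝ) => F (z.1 + (z.2 * s) • e))
    (hF.comp_measurable (by fun_prop))

theorem measurableSet_tendsto_rat_slope {α : Type*} [MeasurableSpace α] {G : α → ℝ → ℝ}
    (hG : ∀ h, Measurable fun x => G x h) {g : α → ℝ} (hg : Measurable g) :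
    MeasurableSet {x | Tendsto (fun q : ℚ => (G x q - G x 0) / q)
      (comap ((↑) : ℚ → ℝ) (𝓝[≠] 0)) (𝓝 (g x))} :=
  measurableSet_tendsto_fun (f := fun (q : ℚ) x => (G x q - G x 0) / q)
    (fun q => ((hG q).sub (hG 0)).div_const _) hg

/-- The difference quotient is continuous away from `0`, so an estimate at rational steps spreads to
all real steps. The rational form involves countably many steps, hence is measurable in a parameter.
-/
theorem hasDerivAt_zero_iff_rat {G : ℝ → ℝ} (hG : Continuous G) (l : ℝ) :
    HasDerivAt G l 0 ↔
      Tendsto (fun q : ℚ => (G q - G 0) / q) (comap ((↑) : ℚ → ℝ) (𝓝[≠] 0)) (𝓝 l) := by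
  have e : HasDerivAt G l 0 ↔ Tendsto (fun h => (G h - G 0) / h) (𝓝[≠] 0) (𝓝 l) := by
    rw [hasDerivAt_iff_tendsto_slope]
    refine tendsto_congr fun h => ?_
    rw [slope_def_field, sub_zero]
  rw [e]
  refine ⟨fun h => h.comp tendsto_comap, fun h => ?_⟩
  refine (Metric.nhds_basis_closedBall.tendsto_right_iff).2 fun ε hε => ?_
  have h1 := (Metric.nhds_basis_closedBall.tendsto_right_iff).1 h ε hε
  rw [eventually_comap, eventually_nhdsWithin_iff] at h1
  obtain ⟨δ, hδ, h2⟩ := Metric.eventually_nhds_iff.1 h1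
  rw [eventually_nhdsWithin_iff, Metric.eventually_nhds_iff]
  refine ⟨δ, hδ, fun y hy hy0 => ?_⟩
  by_contra hcon
  have ho : IsOpen {y : ℝ | y ≠ 0 ∧ dist y 0 < δ} :=
    isOpen_ne.inter (isOpen_lt (continuous_id.dist continuous_const) continuous_const)
  have hc : ContinuousOn (fun h => (G h - G 0) / h) {y : ℝ | y ≠ 0 ∧ dist y 0 < δ} :=
    ContinuousOn.div (by fun_prop) continuousOn_id fun y hy => hy.1
  obtain ⟨q, hq⟩ := Rat.denseRange_cast.exists_mem_open
    (hc.isOpen_inter_preimage ho (Metric.isClosed_closedBall (x := l) (ε := ε)).isOpen_compl)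
    ⟨y, ⟨hy0, hy⟩, hcon⟩
  exact hq.2 (h2 hq.1.2 hq.1.1 q rfl)

/-- Lebesgue differentiation on almost every line. -/
theorem MeasureTheory.Integrable.ae_hasDerivAt_line {F : E → ℝ} (hF : Integrable F μ) (e : E) :
    ∀ᵐ x ∂μ, HasDerivAt (fun h : ℝ => ∫ r in (0 : ℝ)..h, F (x + r • e)) (F x) 0 := by
  -- `ae_of_ae_ae_line` needs a measurable set, so the work is done for a measurable representative;
  -- on almost every line it has the same integrals as `F`.
  obtain ⟨F', hF'm, hFF'⟩ := hF.1
  have hF' : Integrable F' μ := hF.congr hFF'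
  have hcont : ∀ x, LocallyIntegrable (fun r : ℝ => F' (x + r • e)) →
      Continuous fun h : ℝ => ∫ r in (0 : ℝ)..h, F' (x + r • e) := fun x hx =>
    intervalIntegral.continuous_primitive
      (fun a b => intervalIntegrable_iff.2 ((hx.integrableOn_isCompact isCompact_uIcc).mono_set
        uIoc_subset_uIcc)) 0
  have hG : ∀ h : ℝ, Measurable fun x => ∫ r in (0 : ℝ)..h, F' (x + r • e) := fun h =>
    (hF'm.intervalIntegral_line e).measurable.comp (by fun_prop : Measurable fun x : E => (x, h))
  have hloc := hF'.ae_locallyIntegrable_line e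
  have key : ∀ᵐ x ∂μ, Tendsto (fun q : ℚ => ((∫ r in (0 : ℝ)..q, F' (x + r • e)) -
      ∫ r in (0 : ℝ)..0, F' (x + r • e)) / q) (comap ((↑) : ℚ → ℝ) (𝓝[≠] 0)) (𝓝 (F' x)) := by
    refine ae_of_ae_ae_line (e := e) (measurableSet_tendsto_rat_slope hG hF'm.measurable) ?_
    filter_upwards [hloc] with x hx
    filter_upwards [LocallyIntegrable.ae_hasDerivAt_integral hx] with s hs
    have e1 : ∀ h : ℝ, ∫ r in (0 : ℝ)..h, F' (x + s • e + r • e)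
        = ∫ t in s..(h + s), F' (x + t • e) := fun h => by
      have := intervalIntegral.integral_comp_add_right (a := 0) (b := h)
        (fun t => F' (x + t • e)) s
      rw [zero_add] at this
      rw [← this]
      congr 1 with r
      rw [add_smul]; congr 1; abel
    have e2 := funext e1
    have hc : Continuous fun h : ℝ => ∫ r in (0 : ℝ)..h, F' (x + s • e + r • e) := by
      rw [e2]
      exact (intervalIntegral.continuous_primitive (fun a b => intervalIntegrable_iff.2
        ((hx.integrableOn_isCompact isCompact_uIcc).mono_set uIoc_subset_uIcc)) s).comp
          (continuous_add_const s)
    have := (hasDerivAt_zero_iff_rat hc (F' (x + s • e))).1 ?_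
    · exact_mod_cast this
    rw [e2]
    have := (hs s)
    rw [← zero_add s] at this
    simpa using HasDerivAt.comp_add_const 0 s this
  filter_upwards [key, hloc, hFF', ae_ae_line_of_ae hFF' e] with x h1 h2 h3 h4
  rw [h3]
  have e2 : (fun h : ℝ => ∫ r in (0 : ℝ)..h, F (x + r • e)) =
      fun h : ℝ => ∫ r in (0 : ℝ)..h, F' (x + r • e) := by
    ext h
    exact intervalIntegral.integral_congr_ae (h4.mono fun r hr _ => hr)
  rw [e2, hasDerivAt_zero_iff_rat (hcont x h2)]
  exact_mod_cast h1

end Lines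

/-! ### Testing increments against translates of a test function -/

section Core

instance isFiniteMeasure_restrict_uIoc (a b : ℝ) :
    IsFiniteMeasure ((volume : Measure ℝ).restrict (uIoc a b)) :=
  inferInstanceAs (IsFiniteMeasure ((volume : Measure ℝ).restrict (Ioc _ _)))

theorem sub_comp_sub_smul_eq_intervalIntegral {E : Type*} [NormedAddCommGroup E]
    [NormedSpace ℝ E] {η : E → ℝ} (hη : ContDiff ℝ 1 η) (e x : E) (h : ℝ) :
    η (x - h • e) - η x = - ∫ r in (0 : ℝ)..h, fderiv ℝ η (x - r • e) e := by
  have hd : ∀ r : ℝ, HasDerivAt (fun r : ℝ => η (x - r • e)) (-(fderiv ℝ η (x - r • e) e)) r := by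
    intro r
    have h1 : HasDerivAt (fun r : ℝ => x - r • e) (-e) r := by
      simpa using ((hasDerivAt_id r).smul_const e).const_sub x
    have h2 := ((hη.differentiable one_ne_zero) (x - r • e)).hasFDerivAt.comp_hasDerivAt r h1
    rw [map_neg] at h2
    exact h2
  have hc : Continuous fun r : ℝ => -(fderiv ℝ η (x - r • e) e) := by
    have := hη.continuous_fderiv one_ne_zero
    fun_prop
  have := intervalIntegral.integral_eq_sub_of_hasDerivAt (a := 0) (b := h) (fun r _ => hd r)
    (hc.intervalIntegrable _ _)
  rw [intervalIntegral.integral_neg] at this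
  rw [this]; simp

variable {E : Type*} [NormedAddCommGroup E] [NormedSpace ℝ E] [MeasurableSpace E] [BorelSpace E]
  [FiniteDimensional ℝ E] {μ : Measure E} [μ.IsAddHaarMeasure]

theorem integrable_bounded_mul_comp_add_smul {w : E → ℝ} (hw : Continuous w)
    (hc : HasCompactSupport w) {b : E → ℝ} (hb : Integrable b μ) (e : E) (h : ℝ) :
    Integrable (fun z : ℝ × E => w (z.2 - z.1 • e) * b z.2)
      ((volume.restrict (uIoc 0 h)).prod μ) := by
  obtain ⟨C, hC⟩ := hc.exists_bound_of_continuous hw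
  exact (hb.comp_snd _).bdd_mul (c := C)
    (Continuous.aestronglyMeasurable (by fun_prop)) (Eventually.of_forall fun z => hC _)

/-- If `b` is the weak derivative of `a` in direction `e` against the translates of `η` along
a segment, then the increment of `a` is the integral of `b`, when tested with `η`. -/
theorem integral_mul_increment_eq {η : E → ℝ} (hη : ContDiff ℝ 1 η) (hc : HasCompactSupport η)
    {a b : E → ℝ} (ha : Integrable a μ) (hb : Integrable b μ) (e : E) (h : ℝ)
    (H : ∀ r ∈ uIoc 0 h, ∫ x, fderiv ℝ η (x - r • e) e * a x ∂μ
      = - ∫ x, η (x - r • e) * b x ∂μ) :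
    ∫ x, η x * (a (x + h • e) - a x) ∂μ
      = ∫ x, η x * (∫ r in (0 : ℝ)..h, b (x + r • e)) ∂μ := by
  obtain ⟨C, hC⟩ := hc.exists_bound_of_continuous hη.continuous
  have hbdd : ∀ (r : ℝ) {g : E → ℝ}, Integrable g μ →
      Integrable (fun x => η (x - r • e) * g x) μ := fun r g hg =>
    hg.bdd_mul (c := C) (Continuous.aestronglyMeasurable (by have := hη.continuous; fun_prop))
      (Eventually.of_forall fun z => hC _)
  have hbdd0 : ∀ {g : E → ℝ}, Integrable g μ → Integrable (fun x => η x * g x) μ := fun hg => by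
    simpa using hbdd 0 hg
  have htr : ∀ (r : ℝ) (g : E → ℝ), ∫ x, η x * g (x + r • e) ∂μ
      = ∫ x, η (x - r • e) * g x ∂μ := fun r g => by
    rw [← integral_add_right_eq_self (fun x => η (x - r • e) * g x) (r • e)]
    simp
  have hcd : Continuous fun x => fderiv ℝ η x e := by
    have := hη.continuous_fderiv one_ne_zero
    fun_prop
  have hcs : HasCompactSupport fun x => fderiv ℝ η x e := hc.fderiv_apply ℝ e
  have hb2 : Integrable (fun z : ℝ × E => η z.2 * b (z.2 + z.1 • e))
      ((volume.restrict (uIoc 0 h)).prod μ) := by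
    have h1 := (hb.comp_add_smul e (volume.restrict (uIoc 0 h))).swap
    exact h1.bdd_mul (c := C) (Continuous.aestronglyMeasurable
      (hη.continuous.comp continuous_snd)) (Eventually.of_forall fun z => hC _)
  -- The shift moves from `a` to `η`, whose increment is an integral of derivatives of translates.
  -- `H` replaces each of these by `b`, and the shift is moved back.
  calc ∫ x, η x * (a (x + h • e) - a x) ∂μ
      = ∫ x, (η x * a (x + h • e) - η x * a x) ∂μ := by simp_rw [mul_sub]
    _ = ∫ x, η x * a (x + h • e) ∂μ - ∫ x, η x * a x ∂μ :=
        integral_sub (hbdd0 (ha.comp_add_right (h • e))) (hbdd0 ha)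
    _ = ∫ x, η (x - h • e) * a x ∂μ - ∫ x, η x * a x ∂μ := by rw [htr h a]
    _ = ∫ x, (η (x - h • e) * a x - η x * a x) ∂μ := (integral_sub (hbdd h ha) (hbdd0 ha)).symm
    _ = ∫ x, -(∫ r in (0 : ℝ)..h, fderiv ℝ η (x - r • e) e * a x) ∂μ := by
        congr 1 with x
        rw [← sub_mul, sub_comp_sub_smul_eq_intervalIntegral hη,
          intervalIntegral.integral_mul_const]
        ring
    _ = - ∫ r in (0 : ℝ)..h, ∫ x, fderiv ℝ η (x - r • e) e * a x ∂μ := by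
        rw [integral_neg, intervalIntegral_integral_swap
          (integrable_bounded_mul_comp_add_smul hcd hcs ha e h)]
    _ = ∫ r in (0 : ℝ)..h, ∫ x, η (x - r • e) * b x ∂μ := by
        rw [← intervalIntegral.integral_neg]
        refine intervalIntegral.integral_congr_ae (Eventually.of_forall fun r hr => ?_)
        rw [H r hr, neg_neg]
    _ = ∫ r in (0 : ℝ)..h, ∫ x, η x * b (x + r • e) ∂μ := by simp_rw [htr]
    _ = ∫ x, (∫ r in (0 : ℝ)..h, η x * b (x + r • e)) ∂μ := intervalIntegral_integral_swap hb2
    _ = _ := by simp_rw [intervalIntegral.integral_const_mul]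

end Core

/-! ### Increments of a function with a weak derivative, for a fixed step -/

section WeakDerivLines

variable {n : ℕ}

/-- The points `x` such that the segment from `x` to `x + h • e` lies in `Ω`. -/
def segDomain {E : Type*} [AddCommGroup E] [Module ℝ E] (Ω : Set E) (e : E) (h : ℝ) : Set E :=
  {x | ∀ r ∈ uIcc 0 h, x + r • e ∈ Ω}

theorem uIcc_zero_eq_image (h : ℝ) : uIcc 0 h = (fun s => h * s) '' Icc (0 : ℝ) 1 := by
  rw [← segment_eq_uIcc, segment_eq_image_lineMap]
  refine image_congr fun s _ => ?_
  simp [AffineMap.lineMap_apply, mul_comm]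

section

variable {E : Type*} [NormedAddCommGroup E] [NormedSpace ℝ E]

theorem isOpen_setOf_mem_segDomain {Ω : Set E} (hΩ : IsOpen Ω) (e : E) :
    IsOpen {z : E × ℝ | z.1 ∈ segDomain Ω e z.2} := by
  have : {z : E × ℝ | z.1 ∈ segDomain Ω e z.2} =
      {z : E × ℝ | ∀ s ∈ Icc (0 : ℝ) 1, z.1 + (z.2 * s) • e ∈ Ω} := by
    ext z
    simp only [segDomain, mem_ofPred_eq, uIcc_zero_eq_image, forall_mem_image]
  rw [this, isOpen_iff_eventually]
  intro z hz
  refine isCompact_Icc.eventually_forall_of_forall_eventually fun s hs => ?_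
  have hc : Continuous fun y : (E × ℝ) × ℝ => y.1.1 + (y.1.2 * y.2) • e := by fun_prop
  exact (hΩ.preimage hc).mem_nhds (hz s hs)

theorem isOpen_segDomain {Ω : Set E} (hΩ : IsOpen Ω) (e : E) (h : ℝ) :
    IsOpen (segDomain Ω e h) :=
  (isOpen_setOf_mem_segDomain hΩ e).preimage (by fun_prop : Continuous fun x : E => (x, h))

theorem exists_isCompact_tube {Ω C : Set E} (hC : IsCompact C) {e : E} {h : ℝ}
    (hCΩ : C ⊆ segDomain Ω e h) :
    ∃ K ⊆ Ω, IsCompact K ∧ ∀ x ∈ C, ∀ r ∈ uIcc 0 h, x + r • e ∈ K := by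
  refine ⟨(fun z : E × ℝ => z.1 + z.2 • e) '' (C ×ˢ uIcc 0 h), ?_,
    (hC.prod isCompact_uIcc).image (by fun_prop), fun x hx r hr => ⟨(x, r), ⟨hx, hr⟩, rfl⟩⟩
  rintro _ ⟨⟨x, r⟩, ⟨hx, hr⟩, rfl⟩
  exact hCΩ hx r hr

end

theorem IsTestFunction.comp_sub {Ω : Set (EuclideanSpace ℝ (Fin n))}
    {η : EuclideanSpace ℝ (Fin n) → ℝ} (h1 : ContDiff ℝ (⊤ : ℕ∞) η) (h2 : HasCompactSupport η)
    (a : EuclideanSpace ℝ (Fin n)) (h3 : ∀ x ∈ tsupport η, x + a ∈ Ω) :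
    IsTestFunction Ω (fun x => η (x - a)) := by
  refine ⟨h1.comp (contDiff_id.sub contDiff_const),
    h2.comp_homeomorph (Homeomorph.subRight a), ?_⟩
  have := tsupport_comp_eq_preimage η (Homeomorph.subRight a)
  intro x hx
  have hx' : x ∈ (Homeomorph.subRight a) ⁻¹' tsupport η := this ▸ hx
  simpa using h3 _ hx'

/-- By the fundamental lemma of the calculus of variations on the open set `segDomain Ω e h`, it is
enough to test with `η`. Locally `u` and `v` may be cut off to a compact set containing all the
segments involved, which makes them integrable on the whole space. -/
theorem IsWeakPartialDeriv.ae_increment_eq {Ω : Set (EuclideanSpace ℝ (Fin n))} (hΩ : IsOpen Ω)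
    {j : Fin n} {u v : EuclideanSpace ℝ (Fin n) → ℝ} (huv : IsWeakPartialDeriv Ω j u v) (h : ℝ) :
    ∀ᵐ x, x ∈ segDomain Ω (EuclideanSpace.single j (1 : ℝ)) h →
      u (x + h • EuclideanSpace.single j (1 : ℝ)) - u x
        = ∫ r in (0 : ℝ)..h, v (x + r • EuclideanSpace.single j (1 : ℝ)) := by
  set e : EuclideanSpace ℝ (Fin n) := EuclideanSpace.single j (1 : ℝ) with he
  obtain ⟨hu, hv, hw⟩ := huv
  have hind : ∀ {w : EuclideanSpace ℝ (Fin n) → ℝ}, LocL1 Ω w → ∀ K, IsCompact K → K ⊆ Ω →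
      Integrable (K.indicator w) := fun hw K hK hKΩ =>
    (integrable_indicator_iff hK.measurableSet).2 (hw K hK hKΩ)
  have hcongr : ∀ {C K : Set (EuclideanSpace ℝ (Fin n))},
      (∀ x ∈ C, ∀ r ∈ uIcc 0 h, x + r • e ∈ K) → ∀ x ∈ C,
      K.indicator u (x + h • e) - K.indicator u x
          - ∫ r in (0 : ℝ)..h, K.indicator v (x + r • e)
        = u (x + h • e) - u x - ∫ r in (0 : ℝ)..h, v (x + r • e) := by
    intro C K hK x hx
    have h0 : x ∈ K := by simpa using hK x hx 0 left_mem_uIcc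
    rw [indicator_of_mem h0, indicator_of_mem (hK x hx h right_mem_uIcc)]
    congr 1
    exact intervalIntegral.integral_congr fun r hr => indicator_of_mem (hK x hx r hr) _
  have hint : ∀ {w : EuclideanSpace ℝ (Fin n) → ℝ}, Integrable w →
      Integrable (fun x => ∫ r in (0 : ℝ)..h, w (x + r • e)) := by
    intro w hw
    simp_rw [intervalIntegral.intervalIntegral_eq_integral_uIoc]
    exact ((hw.comp_add_smul e (volume.restrict (uIoc 0 h))).integral_prod_left).smul
      (if 0 ≤ h then (1 : ℝ) else -1)
  have key := (isOpen_segDomain hΩ e h).ae_eq_zero_of_integral_contDiff_smul_eq_zero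
    (μ := volume) (f := fun x => u (x + h • e) - u x - ∫ r in (0 : ℝ)..h, v (x + r • e)) ?_ ?_
  · filter_upwards [key] with x hx hxU
    exact sub_eq_zero.1 (hx hxU)
  · rw [locallyIntegrableOn_iff (isOpen_segDomain hΩ e h).isLocallyClosed]
    intro C hCU hC
    obtain ⟨K, hKΩ, hK, hCK⟩ := exists_isCompact_tube hC hCU
    have hI : Integrable fun x => K.indicator u (x + h • e) - K.indicator u x
          - ∫ r in (0 : ℝ)..h, K.indicator v (x + r • e) :=
      (((hind hu K hK hKΩ).comp_add_right (h • e)).sub (hind hu K hK hKΩ)).sub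
        (hint (hind hv K hK hKΩ))
    exact hI.integrableOn.congr_fun (fun x hx => hcongr hCK x hx) hC.measurableSet
  · intro η hη1 hη2 hη3
    obtain ⟨K, hKΩ, hK, hCK⟩ := exists_isCompact_tube hη2 hη3
    have hiu := hind hu K hK hKΩ
    have hiv := hind hv K hK hKΩ
    obtain ⟨C, hC⟩ := hη2.exists_bound_of_continuous hη1.continuous
    have hbdd : ∀ {g : EuclideanSpace ℝ (Fin n) → ℝ}, Integrable g →
        Integrable (fun x => η x * g x) := fun hg =>
      hg.bdd_mul (c := C) hη1.continuous.aestronglyMeasurable (Eventually.of_forall fun z => hC _)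
    have hη1' : ContDiff ℝ 1 η := hη1.of_le (by exact_mod_cast le_top)
    have main := integral_mul_increment_eq hη1' hη2 hiu hiv e h ?_
    · have e1 : ∀ x, η x • (u (x + h • e) - u x - ∫ r in (0 : ℝ)..h, v (x + r • e))
          = η x * (K.indicator u (x + h • e) - K.indicator u x)
            - η x * ∫ r in (0 : ℝ)..h, K.indicator v (x + r • e) := by
        intro x
        by_cases hx : x ∈ tsupport η
        · rw [← hcongr hCK x hx, smul_eq_mul, mul_sub]
        · rw [image_eq_zero_of_notMem_tsupport hx]; simp
      simp_rw [e1]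
      have hi1 : Integrable fun x => η x * (K.indicator u (x + h • e) - K.indicator u x) :=
        hbdd ((hiu.comp_add_right (h • e)).sub hiu)
      rw [integral_sub hi1 (hbdd (hint hiv)), main, sub_self]
    · intro r hr
      have hr' := uIoc_subset_uIcc hr
      have ht : IsTestFunction Ω (fun x => η (x - r • e)) :=
        -- The support of `η` lies in `segDomain Ω e h`, so its translates by `r • e` stay inside
        -- `Ω` for all `r` between `0` and `h`.
        IsTestFunction.comp_sub hη1 hη2 _ fun x hx => hKΩ (hCK x hx r hr')
      have h1 := hw _ ht
      have hK' : ∀ x, x ∉ K → x - r • e ∉ tsupport η := fun x hx hx' => hx (by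
        simpa using hCK _ hx' r hr')
      have hz : ∀ x, x ∉ K → η (x - r • e) = 0 := fun x hx =>
        image_eq_zero_of_notMem_tsupport (hK' x hx)
      have hz' : ∀ x, x ∉ K → fderiv ℝ η (x - r • e) = 0 := fun x hx =>
        image_eq_zero_of_notMem_tsupport fun hx' => hK' x hx (tsupport_fderiv_subset ℝ hx')
      have hfd : ∀ x, fderiv ℝ (fun x => η (x - r • e)) x = fderiv ℝ η (x - r • e) := fun x =>
        fderiv_comp_sub _
      simp_rw [hfd] at h1
      rw [setIntegral_eq_integral_of_forall_compl_eq_zero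
          (fun x hx => by rw [hz' x fun hx' => hx (hKΩ hx')]; simp),
        setIntegral_eq_integral_of_forall_compl_eq_zero
          (fun x hx => by rw [hz x fun hx' => hx (hKΩ hx')]; simp)] at h1
      have e2 : ∀ x, fderiv ℝ η (x - r • e) e * K.indicator u x
          = fderiv ℝ η (x - r • e) e * u x := fun x => by
        by_cases hx : x ∈ K
        · rw [indicator_of_mem hx]
        · rw [hz' x hx]; simp
      have e3 : ∀ x, η (x - r • e) * K.indicator v x = η (x - r • e) * v x := fun x => by
        by_cases hx : x ∈ K
        · rw [indicator_of_mem hx]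
        · rw [hz x hx]; simp
      simp_rw [e2, e3]
      exact h1

end WeakDerivLines

/-! ### Locally integrable functions and increments on almost every line -/

section LocL1Lines

/-- Local integrability thereby reduces to countably many compact sets, so that one null set serves
all compact segments at once. -/
theorem IsOpen.exists_compact_exhaustion {E : Type*} [TopologicalSpace E] [LocallyCompactSpace E]
    [SecondCountableTopology E] {Ω : Set E} (hΩ : IsOpen Ω) :
    ∃ K : ℕ → Set E, (∀ m, IsCompact (K m)) ∧ (∀ m, K m ⊆ Ω) ∧
      ∀ C, IsCompact C → C ⊆ Ω → ∃ m, C ⊆ K m := by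
  have : LocallyCompactSpace Ω := hΩ.locallyCompactSpace
  let K : CompactExhaustion Ω := default
  refine ⟨fun m => (↑) '' K m, fun m => (K.isCompact m).image continuous_subtype_val,
    fun m => by rintro _ ⟨x, -, rfl⟩; exact x.2, fun C hC hCΩ => ?_⟩
  obtain ⟨m, hm⟩ := K.exists_superset_of_isCompact
    (s := ((↑) : Ω → E) ⁻¹' C) (Topology.IsInducing.subtypeVal.isCompact_preimage' hC (by simpa))
  exact ⟨m, fun x hx => ⟨⟨x, hCΩ hx⟩, hm hx, rfl⟩⟩

variable {n : ℕ} {Ω : Set (EuclideanSpace ℝ (Fin n))}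

theorem LocL1.aestronglyMeasurable (hΩ : IsOpen Ω) {u : EuclideanSpace ℝ (Fin n) → ℝ}
    (hu : LocL1 Ω u) : AEStronglyMeasurable u (volume.restrict Ω) := by
  obtain ⟨K, hK, hKΩ, hex⟩ := hΩ.exists_compact_exhaustion
  have : Ω = ⋃ m, K m := by
    refine subset_antisymm (fun x hx => ?_) (iUnion_subset hKΩ)
    obtain ⟨m, hm⟩ := hex {x} isCompact_singleton (by simpa)
    exact mem_iUnion.2 ⟨m, hm rfl⟩
  rw [this, aestronglyMeasurable_iUnion_iff]
  exact fun m => (hu _ (hK m) (hKΩ m)).1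

theorem LocL1.congr {u u' : EuclideanSpace ℝ (Fin n) → ℝ} (hu : LocL1 Ω u)
    (h : u =ᵐ[volume.restrict Ω] u') : LocL1 Ω u' := fun K hK hKΩ =>
  (hu K hK hKΩ).congr (ae_restrict_of_ae_restrict_of_subset hKΩ h)

theorem IsWeakPartialDeriv.congr {j : Fin n} {u v u' v' : EuclideanSpace ℝ (Fin n) → ℝ}
    (h : IsWeakPartialDeriv Ω j u v) (hu : u =ᵐ[volume.restrict Ω] u')
    (hv : v =ᵐ[volume.restrict Ω] v') : IsWeakPartialDeriv Ω j u' v' := by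
  refine ⟨h.1.congr hu, h.2.1.congr hv, fun η hη => ?_⟩
  rw [← integral_congr_ae (hu.mono fun x hx => congrArg
      (fderiv ℝ η x (EuclideanSpace.single j (1 : ℝ)) * ·) hx),
    ← integral_congr_ae (hv.mono fun x hx => congrArg (η x * ·) hx)]
  exact h.2.2 η hη

theorem LocL1.integrable_indicator {v : EuclideanSpace ℝ (Fin n) → ℝ} (hv : LocL1 Ω v)
    {K : Set (EuclideanSpace ℝ (Fin n))} (hK : IsCompact K) (hKΩ : K ⊆ Ω) :
    Integrable (K.indicator v) :=
  (integrable_indicator_iff hK.measurableSet).2 (hv K hK hKΩ)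

theorem LocL1.ae_intervalIntegrable_line (hΩ : IsOpen Ω) {v : EuclideanSpace ℝ (Fin n) → ℝ}
    (hv : LocL1 Ω v) (e : EuclideanSpace ℝ (Fin n)) :
    ∀ᵐ x, ∀ a b : ℝ, (∀ t ∈ uIcc a b, x + t • e ∈ Ω) →
      IntervalIntegrable (fun r : ℝ => v (x + r • e)) volume a b := by
  obtain ⟨K, hK, hKΩ, hex⟩ := hΩ.exists_compact_exhaustion
  have h : ∀ᵐ x, ∀ m, LocallyIntegrable (fun r : ℝ => (K m).indicator v (x + r • e)) :=
    ae_all_iff.2 fun m => (hv.integrable_indicator (hK m) (hKΩ m)).ae_locallyIntegrable_line e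
  filter_upwards [h] with x hx a b hab
  obtain ⟨m, hm⟩ := hex ((fun t : ℝ => x + t • e) '' uIcc a b)
    (isCompact_uIcc.image (by fun_prop)) (image_subset_iff.2 hab)
  have h1 := (hx m).integrableOn_isCompact (isCompact_uIcc (a := a) (b := b))
  rw [intervalIntegrable_iff']
  exact h1.congr_fun (fun t ht => indicator_of_mem (hm ⟨t, ht, rfl⟩) _) measurableSet_uIcc

theorem LocL1.ae_hasDerivAt_line (hΩ : IsOpen Ω) {v : EuclideanSpace ℝ (Fin n) → ℝ}
    (hv : LocL1 Ω v) (e : EuclideanSpace ℝ (Fin n)) :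
    ∀ᵐ x, x ∈ Ω → HasDerivAt (fun h : ℝ => ∫ r in (0 : ℝ)..h, v (x + r • e)) (v x) 0 := by
  obtain ⟨K, hK, hKΩ, hex⟩ := hΩ.exists_compact_exhaustion
  have h : ∀ᵐ x, ∀ m, HasDerivAt (fun h : ℝ => ∫ r in (0 : ℝ)..h, (K m).indicator v (x + r • e))
      ((K m).indicator v x) 0 :=
    ae_all_iff.2 fun m => (hv.integrable_indicator (hK m) (hKΩ m)).ae_hasDerivAt_line e
  filter_upwards [h] with x hx hxΩ
  have hc : ContinuousAt (fun t : ℝ => x + t • e) 0 := by fun_prop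
  obtain ⟨ε, hε, hεΩ⟩ := Metric.nhds_basis_closedBall.mem_iff.1
    (hc.preimage_mem_nhds (hΩ.mem_nhds (by simpa using hxΩ)))
  obtain ⟨m, hm⟩ := hex ((fun t : ℝ => x + t • e) '' Metric.closedBall 0 ε)
    ((isCompact_closedBall _ _).image (by fun_prop)) (image_subset_iff.2 hεΩ)
  have hmem : ∀ t ∈ Metric.closedBall (0 : ℝ) ε, x + t • e ∈ K m := fun t ht => hm ⟨t, ht, rfl⟩
  have hxm : x ∈ K m := by simpa using hmem 0 (Metric.mem_closedBall_self hε.le)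
  have h1 := hx m
  rw [indicator_of_mem hxm] at h1
  refine h1.congr_of_eventuallyEq ?_
  filter_upwards [Metric.closedBall_mem_nhds (0 : ℝ) hε] with h hh
  refine intervalIntegral.integral_congr fun r hr => (indicator_of_mem (hmem r ?_) _).symm
  exact ((convex_closedBall (0 : ℝ) ε).ordConnected.uIcc_subset
    (Metric.mem_closedBall_self hε.le) hh) hr

theorem ae_ae_line_of_ae_restrict (hΩ : MeasurableSet Ω) {P : EuclideanSpace ℝ (Fin n) → Prop}
    (h : ∀ᵐ x ∂(volume.restrict Ω), P x) (e : EuclideanSpace ℝ (Fin n)) :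
    ∀ᵐ x, ∀ᵐ r : ℝ, x + r • e ∈ Ω → P (x + r • e) :=
  ae_ae_line_of_ae ((ae_restrict_iff' hΩ).1 h) e

theorem IsWeakPartialDeriv.ae_ae_increment_eq (hΩ : IsOpen Ω)
    {j : Fin n} {u v : EuclideanSpace ℝ (Fin n) → ℝ} (huv : IsWeakPartialDeriv Ω j u v) :
    ∀ᵐ x, ∀ᵐ h : ℝ, x ∈ segDomain Ω (EuclideanSpace.single j (1 : ℝ)) h →
      u (x + h • EuclideanSpace.single j (1 : ℝ)) - u x
        = ∫ r in (0 : ℝ)..h, v (x + r • EuclideanSpace.single j (1 : ℝ)) := by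
  obtain ⟨u', hu', huu'⟩ := huv.1.aestronglyMeasurable hΩ
  obtain ⟨v', hv', hvv'⟩ := huv.2.1.aestronglyMeasurable hΩ
  have huv' := huv.congr huu' hvv'
  set e : EuclideanSpace ℝ (Fin n) := EuclideanSpace.single j (1 : ℝ) with he
  have hmeas : MeasurableSet {z : EuclideanSpace ℝ (Fin n) × ℝ | z.1 ∈ segDomain Ω e z.2 →
      u' (z.1 + z.2 • e) - u' z.1 = ∫ r in (0 : ℝ)..z.2, v' (z.1 + r • e)} := by
    refine (isOpen_setOf_mem_segDomain hΩ e).measurableSet.imp ?_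
    refine measurableSet_eq_fun ?_ (hv'.intervalIntegral_line e).measurable
    exact (hu'.measurable.comp (by fun_prop)).sub (hu'.measurable.comp (by fun_prop))
  -- For each `h` the identity holds for almost every `x`; the exchange to almost every `h` for a
  -- fixed `x` needs the measurable representatives.
  have h1 := (Measure.ae_ae_comm (μ := volume) (ν := volume)
    (p := fun (x : EuclideanSpace ℝ (Fin n)) (h : ℝ) => x ∈ segDomain Ω e h →
      u' (x + h • e) - u' x = ∫ r in (0 : ℝ)..h, v' (x + r • e)) hmeas).2
    (Eventually.of_forall fun h => huv'.ae_increment_eq hΩ h)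
  filter_upwards [h1, (ae_restrict_iff' hΩ.measurableSet).1 huu',
    ae_ae_line_of_ae_restrict hΩ.measurableSet huu' e,
    ae_ae_line_of_ae_restrict hΩ.measurableSet hvv' e] with x h2 h3 h4 h5
  filter_upwards [h2, h4] with h h6 h7 hseg
  have hx0 : x ∈ Ω := by simpa using hseg 0 left_mem_uIcc
  rw [h7 (hseg h right_mem_uIcc), h3 hx0, h6 hseg]
  refine intervalIntegral.integral_congr_ae (h5.mono fun r hr hr' => ?_)
  exact (hr (hseg r (uIoc_subset_uIcc hr'))).symm

/-- Both points satisfy the increment formula for almost every step, so a common third point `x + h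
• e` with `h` near `c` can be chosen where both formulas hold; subtracting them gives the claim.
Thus the points that are good for almost every step are good for each other. -/
theorem increment_eq_of_ae_increment_eq {E : Type*} [NormedAddCommGroup E] [NormedSpace ℝ E]
    {Ω : Set E} (hΩ : IsOpen Ω) {u v : E → ℝ} {e x : E} {c : ℝ}
    (hi : ∀ a b : ℝ, (∀ t ∈ uIcc a b, x + t • e ∈ Ω) →
      IntervalIntegrable (fun r : ℝ => v (x + r • e)) volume a b)
    (hx : ∀ᵐ h : ℝ, x ∈ segDomain Ω e h →
      u (x + h • e) - u x = ∫ r in (0 : ℝ)..h, v (x + r • e))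
    (hy : ∀ᵐ h : ℝ, x + c • e ∈ segDomain Ω e h →
      u (x + c • e + h • e) - u (x + c • e) = ∫ r in (0 : ℝ)..h, v (x + c • e + r • e))
    (hc : x ∈ segDomain Ω e c) :
    u (x + c • e) - u x = ∫ r in (0 : ℝ)..c, v (x + r • e) := by
  have hy' := (measurePreserving_add_right (volume : Measure ℝ) (-c)).quasiMeasurePreserving.ae hy
  have ho1 : IsOpen {h : ℝ | x ∈ segDomain Ω e h} :=
    (isOpen_setOf_mem_segDomain hΩ e).preimage (by fun_prop : Continuous fun h : ℝ => (x, h))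
  have ho2 : IsOpen {h : ℝ | x + c • e ∈ segDomain Ω e (h + -c)} :=
    (isOpen_setOf_mem_segDomain hΩ e).preimage
      (by fun_prop : Continuous fun h : ℝ => (x + c • e, h + -c))
  have hmem : c ∈ {h : ℝ | x ∈ segDomain Ω e h} ∩ {h : ℝ | x + c • e ∈ segDomain Ω e (h + -c)} := by
    refine ⟨hc, ?_⟩
    intro r hr
    rw [add_neg_cancel, uIcc_self, mem_singleton_iff] at hr
    subst hr
    simpa using hc c right_mem_uIcc
  obtain ⟨h, ⟨h1, h2⟩, h3, h4⟩ := (Measure.dense_of_ae (hx.and hy')).inter_open_nonempty _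
    (ho1.inter ho2) ⟨c, hmem⟩
  have e1 := h3 h1
  have e2 := h4 h2
  have e3 : x + c • e + (h + -c) • e = x + h • e := by rw [add_smul, neg_smul]; abel
  have e4 : ∫ r in (0 : ℝ)..(h + -c), v (x + c • e + r • e) = ∫ r in c..h, v (x + r • e) := by
    have := intervalIntegral.integral_comp_add_right (a := 0) (b := h + -c)
      (fun t => v (x + t • e)) c
    rw [zero_add, neg_add_cancel_right] at this
    rw [← this]
    congr 1 with r
    rw [add_smul]; congr 1; abel
  rw [e3, e4] at e2
  have hi1 := hi 0 c hc
  have hi2 := hi 0 h h1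
  have := intervalIntegral.integral_add_adjacent_intervals hi1 (hi1.symm.trans hi2)
  linarith

end LocL1Lines

/-! ### Banach limits -/

section BanachLimit

/-- Positivity needs an inequality at every index, so `c k` is replaced by `max |a k| (c k)`, which
has the same limit. -/
theorem IsBanachLimit.abs_le_of_eventually_le {L : lp (fun _ : ℕ => ℝ) ∞ →L[ℝ] ℝ}
    (hL : IsBanachLimit L) (a : lp (fun _ : ℕ => ℝ) ∞) {c : ℕ → ℝ} {l : ℝ}
    (hc : Tendsto c atTop (𝓝 l)) (hac : ∀ᶠ k in atTop, |a k| ≤ c k) : |L a| ≤ l := by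
  have hb : Tendsto (fun k => max |a k| (c k)) atTop (𝓝 l) :=
    hc.congr' (hac.mono fun k hk => (max_eq_right hk).symm)
  have hmem : Memℓp (fun k => max |a k| (c k)) ∞ := by
    obtain ⟨B, hB⟩ := hb.norm.bddAbove_range
    exact memℓp_infty ⟨B, hB⟩
  set b : lp (fun _ : ℕ => ℝ) ∞ := ⟨_, hmem⟩ with hbdef
  have hb' : L b = l := hL.eq_lim b l hb
  have h1 := hL.nonneg (b - a) fun k => by
    simp only [lp.coeFn_sub, Pi.sub_apply, sub_nonneg]
    exact (le_abs_self _).trans (le_max_left _ _)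
  have h2 := hL.nonneg (b + a) fun k => by
    simp only [lp.coeFn_add, Pi.add_apply]
    have : |a k| ≤ b k := le_max_left _ _
    linarith [neg_abs_le (a k)]
  rw [map_sub, hb'] at h1
  rw [map_add, hb'] at h2
  exact abs_le.2 ⟨by linarith, by linarith⟩

/-- The limit along a nonprincipal ultrafilter is such a functional; shift invariance is not part of
the definition. -/
theorem exists_isBanachLimit : ∃ L : lp (fun _ : ℕ => ℝ) ∞ →L[ℝ] ℝ, IsBanachLimit L := by
  have hlim : ∀ a : lp (fun _ : ℕ => ℝ) ∞, ∃ l ∈ Metric.closedBall (0 : ℝ) ‖a‖,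
      Tendsto (fun k => a k) (hyperfilter ℕ : Filter ℕ) (𝓝 l) := fun a => by
    have := (isCompact_closedBall (0 : ℝ) ‖a‖).ultrafilter_le_nhds
      ((hyperfilter ℕ).map fun k => a k) (le_principal_iff.2 (mem_map.2
        (univ_mem' fun k => by
          simpa using lp.norm_apply_le_norm ENNReal.top_ne_zero a k)))
    exact this
  choose l hl hlt using hlim
  let L₀ : lp (fun _ : ℕ => ℝ) ∞ →ₗ[ℝ] ℝ :=
    { toFun := l
      map_add' := fun a b => tendsto_nhds_unique (hlt (a + b)) (by
        simpa using (hlt a).add (hlt b))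
      map_smul' := fun c a => tendsto_nhds_unique (hlt (c • a)) (by
        simpa using (hlt a).const_mul c) }
  refine ⟨L₀.mkContinuous 1 fun a => ?_, fun a x hx => ?_, fun a ha => ?_⟩
  · simpa [L₀] using hl a
  · exact tendsto_nhds_unique (hlt a) (hx.mono_left Nat.hyperfilter_le_atTop)
  · exact ge_of_tendsto' (hlt a) ha

theorem exists_isStepSequence : ∃ δ : ℕ → ℝ, IsStepSequence δ :=
  ⟨fun k => 1 / ((k : ℝ) + 1), fun k => by positivity, tendsto_one_div_add_atTop_nhds_zero_nat⟩

end BanachLimit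

/-! ### From almost everywhere to everywhere on an interval, and absolute continuity -/

section OneDim

theorem le_on_uIcc_of_ae_le {f g : ℝ → ℝ} {a b : ℝ} (hab : a ≠ b)
    (h : ∀ᵐ r : ℝ, r ∈ uIcc a b → f r ≤ g r) (hf : ContinuousOn f (uIcc a b))
    (hg : ContinuousOn g (uIcc a b)) : ∀ r ∈ uIcc a b, f r ≤ g r := by
  have hne : min a b ≠ max a b := by simpa using hab
  have h1 : (fun r => max (f r) (g r)) =ᵐ[volume.restrict (Icc (min a b) (max a b))] g :=
    (ae_restrict_iff' measurableSet_Icc).2 (h.mono fun r hr hr' => max_eq_right (hr hr'))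
  intro r hr
  have := Measure.eqOn_Icc_of_ae_eq volume hne h1 (hf.sup hg) hg hr
  exact max_eq_right_iff.1 this

/-- The primitive of `m` is absolutely continuous, and its increments dominate those of `γ`. -/
theorem AbsolutelyContinuousOnInterval.of_dist_le {X : Type*} [PseudoMetricSpace X] {γ : ℝ → X}
    {m : ℝ → ℝ} {a b : ℝ} (hm : IntervalIntegrable m volume a b)
    (h : ∀ s ∈ uIcc a b, ∀ t ∈ uIcc a b, dist (γ s) (γ t) ≤ |∫ r in s..t, m r|) :
    AbsolutelyContinuousOnInterval γ a b := by
  have hF := hm.absolutelyContinuousOnInterval_intervalIntegral (c := a) left_mem_uIcc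
  rw [absolutelyContinuousOnInterval_iff] at hF ⊢
  intro ε hε
  obtain ⟨δ, hδ, hE⟩ := hF ε hε
  refine ⟨δ, hδ, fun E hEm hEs => (Finset.sum_le_sum fun i hi => ?_).trans_lt (hE E hEm hEs)⟩
  have hi' := hEm.1 i hi
  refine (h _ hi'.1 _ hi'.2).trans_eq ?_
  have hsub : ∀ t ∈ uIcc a b, IntervalIntegrable m volume a t := fun t ht =>
    hm.mono_set (uIcc_subset_uIcc left_mem_uIcc ht)
  rw [Real.dist_eq, abs_sub_comm,
    intervalIntegral.integral_interval_sub_left (hsub _ hi'.2) (hsub _ hi'.1)]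

end OneDim

/-! ### Pointwise estimates for the canonical derivative -/

section CanonicalDeriv

variable {n : ℕ} {X : Type*} [MetricSpace X] {z₀ : X}

theorem LipZero.norm_distFun_le (z₀ a : X) : ‖LipZero.distFun z₀ a‖ ≤ 1 :=
  LipZero.norm_le zero_le_one fun x y => by
    change |dist x a - dist z₀ a - (dist y a - dist z₀ a)| ≤ _
    rw [sub_sub_sub_cancel_right, one_mul]
    exact abs_dist_sub_le x y a

theorem LipZero.continuous (φ : LipZero z₀) : Continuous (φ : X → ℝ) := by
  obtain ⟨K, hK⟩ := φ.2.1
  exact hK.continuous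

/-- The normalising constants cancel, and a `z k` close to `b` makes `dist a (z k) - dist b (z k)`
almost `dist a b`. Only one of the two points has to be in the closure. -/
theorem dist_le_of_forall_distFun {z : ℕ → X} {a b : X} (hb : b ∈ closure (range z)) {C : ℝ}
    (h : ∀ k, |LipZero.distFun z₀ (z k) a - LipZero.distFun z₀ (z k) b| ≤ C) : dist a b ≤ C := by
  refine le_of_forall_pos_le_add fun ε hε => ?_
  obtain ⟨_, ⟨k, rfl⟩, hk⟩ := Metric.mem_closure_iff.1 hb (ε / 2) (half_pos hε)
  have h1 : |dist a (z k) - dist z₀ (z k) - (dist b (z k) - dist z₀ (z k))| ≤ C := h k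
  rw [sub_sub_sub_cancel_right] at h1
  linarith [dist_triangle a (z k) b, dist_comm (z k) b, (abs_le.1 h1).2]

theorem HasBoundedQuotients.canonicalDeriv_apply {ν : EuclideanSpace ℝ (Fin n)}
    {f : EuclideanSpace ℝ (Fin n) → X} {x : EuclideanSpace ℝ (Fin n)}
    (h : HasBoundedQuotients z₀ ν f x) {δ : ℕ → ℝ} (hδ : IsStepSequence δ)
    (L : lp (fun _ : ℕ => ℝ) ∞ →L[ℝ] ℝ) (φ : LipZero z₀) :
    canonicalDeriv z₀ L hδ ν f x φ = L ⟨diffQuot δ ν f x φ, h.memlp hδ φ⟩ := by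
  rw [canonicalDeriv, dif_pos h]
  rfl

theorem IsStepSequence.tendsto_nhdsNE {δ : ℕ → ℝ} (hδ : IsStepSequence δ) :
    Tendsto δ atTop (𝓝[≠] 0) :=
  tendsto_nhdsWithin_iff.2 ⟨hδ.tendsto, Eventually.of_forall fun k => (hδ.pos k).ne'⟩

/-- The hypotheses say that `∫ m` controls the increments of `f` near `x` and that `x` is a
Lebesgue point of `m` on the line. -/
theorem hasBoundedQuotients_of_dist_le {ν : EuclideanSpace ℝ (Fin n)}
    {f : EuclideanSpace ℝ (Fin n) → X} {x : EuclideanSpace ℝ (Fin n)} {M : ℝ → ℝ} {l : ℝ}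
    (hM : Tendsto (fun h => |M h| / |h|) (𝓝[≠] 0) (𝓝 l))
    (h : ∀ᶠ h in 𝓝 (0 : ℝ), dist (f x) (f (x + h • ν)) ≤ |M h|) :
    HasBoundedQuotients z₀ ν f x := by
  -- The added `1` makes the constant positive and leaves room for the quotients to be eventually
  -- below it.
  refine ⟨|l| + 1, by positivity, fun φ => limsup_le_of_le (by isBoundedDefault) ?_⟩
  filter_upwards [hM.eventually_lt_const (u := |l| + 1) (by linarith [le_abs_self l]),
    h.filter_mono nhdsWithin_le_nhds] with h h1 h2
  refine ENNReal.ofReal_le_ofReal ?_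
  calc |φ (f (x + h • ν)) - φ (f x)| / |h| ≤ (‖φ‖ * |M h|) / |h| := by
        gcongr
        refine (LipZero.abs_sub_le φ _ _).trans ?_
        rw [dist_comm]
        exact mul_le_mul_of_nonneg_left h2 (norm_nonneg φ)
    _ = |M h| / |h| * ‖φ‖ := by ring
    _ ≤ _ := mul_le_mul_of_nonneg_right h1.le (norm_nonneg φ)

theorem norm_canonicalDeriv_le {ν : EuclideanSpace ℝ (Fin n)}
    {f : EuclideanSpace ℝ (Fin n) → X} {x : EuclideanSpace ℝ (Fin n)} {M : ℝ → ℝ} {l : ℝ}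
    (hM : Tendsto (fun h => |M h| / |h|) (𝓝[≠] 0) (𝓝 l))
    (h : ∀ᶠ h in 𝓝 (0 : ℝ), dist (f x) (f (x + h • ν)) ≤ |M h|)
    {L : lp (fun _ : ℕ => ℝ) ∞ →L[ℝ] ℝ} (hL : IsBanachLimit L) {δ : ℕ → ℝ}
    (hδ : IsStepSequence δ) : ‖canonicalDeriv z₀ L hδ ν f x‖ ≤ l := by
  have hb := hasBoundedQuotients_of_dist_le (z₀ := z₀) hM h
  have hl : 0 ≤ l := ge_of_tendsto' hM fun h => by positivity
  refine ContinuousLinearMap.opNorm_le_bound _ hl fun φ => ?_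
  rw [hb.canonicalDeriv_apply hδ L φ, Real.norm_eq_abs]
  refine hL.abs_le_of_eventually_le _ ((hM.comp hδ.tendsto_nhdsNE).mul_const ‖φ‖) ?_
  filter_upwards [hδ.tendsto.eventually h] with k hk
  change |(φ (f (x + δ k • ν)) - φ (f x)) / δ k| ≤ |M (δ k)| / |δ k| * ‖φ‖
  rw [abs_div, div_mul_eq_mul_div]
  gcongr
  refine (LipZero.abs_sub_le φ _ _).trans ?_
  rw [dist_comm, mul_comm]
  exact mul_le_mul_of_nonneg_right hk (norm_nonneg φ)

theorem HasBoundedQuotients.canonicalDeriv_eq {ν : EuclideanSpace ℝ (Fin n)}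
    {f : EuclideanSpace ℝ (Fin n) → X} {x : EuclideanSpace ℝ (Fin n)}
    (h : HasBoundedQuotients z₀ ν f x) {L : lp (fun _ : ℕ => ℝ) ∞ →L[ℝ] ℝ}
    (hL : IsBanachLimit L) {δ : ℕ → ℝ} (hδ : IsStepSequence δ) {φ : LipZero z₀} {l : ℝ}
    (hd : HasDerivAt (fun h : ℝ => φ (f (x + h • ν))) l 0) :
    canonicalDeriv z₀ L hδ ν f x φ = l := by
  rw [h.canonicalDeriv_apply hδ L φ]
  refine hL.eq_lim _ _ ?_
  have := (hasDerivAt_iff_tendsto_slope.1 hd).comp hδ.tendsto_nhdsNE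
  refine this.congr fun k => ?_
  simp [slope_def_field, diffQuot]

end CanonicalDeriv

/-! ### The speed of a Sobolev map and its control of increments -/

section MetricLines

variable {n : ℕ} {X : Type*} [MetricSpace X] {z₀ : X} {Ω : Set (EuclideanSpace ℝ (Fin n))}
  {p : ℝ≥0∞}

theorem MemLp.locL1 (hp : 1 ≤ p) {u : EuclideanSpace ℝ (Fin n) → ℝ}
    (hu : MemLp u p (volume.restrict Ω)) : LocL1 Ω u := fun K hK hKΩ => by
  have : IsFiniteMeasure (volume.restrict K) := isFiniteMeasure_restrict.2 hK.measure_lt_top.ne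
  exact (hu.mono_measure (Measure.restrict_mono_set volume hKΩ)).integrable hp

theorem MemLpMetric.locL1Metric (hp : 1 ≤ p) {f : EuclideanSpace ℝ (Fin n) → X}
    (hf : MemLpMetric Ω z₀ p f) : LocL1Metric Ω z₀ f := fun K hK hKΩ => by
  have : IsFiniteMeasure (volume.restrict K) := isFiniteMeasure_restrict.2 hK.measure_lt_top.ne
  have h := Measure.restrict_mono_set (volume : Measure (EuclideanSpace ℝ (Fin n))) hKΩ
  exact ⟨hf.1.mono_measure h, (hf.2.mono_measure h).mono_exponent hp⟩

/-- The speed `m` of `f` in the direction `e_j`: a function controlling exactly the weak derivatives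
of the distance functions from a sequence that is dense in the essential range of `f`. -/
theorem MemW1pMetric.exists_speed (hΩ : IsOpen Ω) {f : EuclideanSpace ℝ (Fin n) → X}
    (hf : MemW1pMetric Ω z₀ p f) (j : Fin n) :
    ∃ (z : ℕ → X) (V : LipZero z₀ → EuclideanSpace ℝ (Fin n) → ℝ)
      (m : EuclideanSpace ℝ (Fin n) → ℝ),
      (∀ᵐ x ∂(volume.restrict Ω), f x ∈ closure (range z)) ∧
      (∀ φ : LipZero z₀, IsWeakPartialDeriv Ω j (fun x => φ (f x)) (V φ)) ∧
      MemLp m p (volume.restrict Ω) ∧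
      (∀ᵐ x ∂(volume.restrict Ω), ∀ k, |V (LipZero.distFun z₀ (z k)) x| ≤ m x) ∧
      ∀ x C, (∀ k, |V (LipZero.distFun z₀ (z k)) x| ≤ C) → m x ≤ C := by
  obtain ⟨⟨hfm, hfp⟩, hφ, g, hg, hG⟩ := hf
  obtain ⟨t, ⟨c, hc, htc⟩, hft⟩ := hfm.isSeparable_ae_range
  -- Inserting `z₀` makes the countable set nonempty, so that a sequence can enumerate it.
  obtain ⟨z, hz⟩ := (hc.insert z₀).exists_eq_range (insert_nonempty _ _)
  choose V hV hVp using fun φ => (hφ φ).2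
  have hbound : ∀ᵐ x ∂(volume.restrict Ω), ∀ k, |V (LipZero.distFun z₀ (z k)) j x| ≤ |g x| := by
    refine ae_all_iff.2 fun k => ?_
    -- The upper gradient condition concerns whole gradients, so all components are assembled and
    -- only the `j`-th is kept.
    filter_upwards [hG (LipZero.distFun z₀ (z k))
      (fun x => WithLp.toLp 2 fun i => V (LipZero.distFun z₀ (z k)) i x) fun i => hV _ i] with x hx
    have h1 := PiLp.norm_apply_le
      (WithLp.toLp 2 fun i => V (LipZero.distFun z₀ (z k)) i x : EuclideanSpace ℝ (Fin n)) j
    refine h1.trans (hx.trans ?_)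
    exact (mul_le_mul_of_nonneg_left (le_abs_self _) (norm_nonneg _)).trans
      (mul_le_of_le_one_left (abs_nonneg _) (LipZero.norm_distFun_le _ _))
  refine ⟨z, fun φ => V φ j, fun x => ⨆ k, |V (LipZero.distFun z₀ (z k)) j x|, ?_,
    fun φ => hV φ j, ?_, ?_, fun x C hC => ciSup_le hC⟩
  · filter_upwards [hft] with x hx
    exact closure_mono (by rw [← hz]; exact subset_insert _ _) (htc hx)
  · refine hg.mono ?_ ?_
    · exact (AEMeasurable.iSup fun k =>
        ((hV _ j).2.1.aestronglyMeasurable hΩ).aemeasurable.abs).aestronglyMeasurable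
    · filter_upwards [hbound] with x hx
      rw [Real.norm_eq_abs, abs_of_nonneg (Real.iSup_nonneg fun k => abs_nonneg _)]
      exact ciSup_le hx
  · filter_upwards [hbound] with x hx k
    exact le_ciSup (f := fun k => |V (LipZero.distFun z₀ (z k)) j x|)
      ⟨|g x|, by rintro _ ⟨k, rfl⟩; exact hx k⟩ k

/-- Increments of `f` on almost every line, between points of a set of full measure, are controlled
by the speed. -/
theorem exists_ae_dist_le_integral (hΩ : IsOpen Ω) {f : EuclideanSpace ℝ (Fin n) → X} {j : Fin n}
    {z : ℕ → X} {V : LipZero z₀ → EuclideanSpace ℝ (Fin n) → ℝ}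
    {m : EuclideanSpace ℝ (Fin n) → ℝ} (hm : LocL1 Ω m)
    (hz : ∀ᵐ x ∂(volume.restrict Ω), f x ∈ closure (range z))
    (hV : ∀ φ : LipZero z₀, IsWeakPartialDeriv Ω j (fun x => φ (f x)) (V φ))
    (hVm : ∀ᵐ x ∂(volume.restrict Ω), ∀ k, |V (LipZero.distFun z₀ (z k)) x| ≤ m x) :
    ∃ G : Set (EuclideanSpace ℝ (Fin n)), (∀ᵐ x ∂(volume.restrict Ω), x ∈ G) ∧
      ∀ᵐ x, ∀ s t : ℝ, (∀ r ∈ uIcc s t, x + r • EuclideanSpace.single j (1 : ℝ) ∈ Ω) →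
        x + s • EuclideanSpace.single j (1 : ℝ) ∈ G → x + t • EuclideanSpace.single j (1 : ℝ) ∈ G →
        dist (f (x + s • EuclideanSpace.single j (1 : ℝ)))
          (f (x + t • EuclideanSpace.single j (1 : ℝ)))
          ≤ |∫ r in s..t, m (x + r • EuclideanSpace.single j (1 : ℝ))| := by
  set e : EuclideanSpace ℝ (Fin n) := EuclideanSpace.single j (1 : ℝ) with he
  -- `G` consists of the points from which the increment formula holds for every `k` and almost
  -- every step; two such points on one segment can then be compared by
  -- `increment_eq_of_ae_increment_eq`.
  refine ⟨{x | f x ∈ closure (range z) ∧ ∀ k, ∀ᵐ h : ℝ, x ∈ segDomain Ω e h →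
    LipZero.distFun z₀ (z k) (f (x + h • e)) - LipZero.distFun z₀ (z k) (f x)
      = ∫ r in (0 : ℝ)..h, V (LipZero.distFun z₀ (z k)) (x + r • e)}, ?_, ?_⟩
  · exact hz.and (ae_restrict_of_ae (ae_all_iff.2 fun k => (hV _).ae_ae_increment_eq hΩ))
  · have hi : ∀ᵐ x, ∀ k, ∀ a b : ℝ, (∀ t ∈ uIcc a b, x + t • e ∈ Ω) → IntervalIntegrable
        (fun r : ℝ => V (LipZero.distFun z₀ (z k)) (x + r • e)) volume a b :=
      ae_all_iff.2 fun k => (hV _).2.1.ae_intervalIntegrable_line hΩ e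
    filter_upwards [hi, hm.ae_intervalIntegrable_line hΩ e,
      ae_ae_line_of_ae_restrict hΩ.measurableSet hVm e] with x h1 h2 h3 s t hst hs ht
    refine dist_le_of_forall_distFun (z₀ := z₀) ht.1 fun k => ?_
    have e1 : ∀ r : ℝ, x + s • e + r • e = x + (r + s) • e := fun r => by
      rw [add_smul]; abel
    have e2 : ∀ h : ℝ, uIcc (0 + s) (h + s) = (· + s) '' uIcc 0 h := fun h => by simp
    have hseg : x + s • e ∈ segDomain Ω e (t - s) := fun r hr => by
      rw [e1]
      refine hst _ ?_
      have := mem_image_of_mem (· + s) hr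
      rwa [← e2, zero_add, sub_add_cancel] at this
    have key := increment_eq_of_ae_increment_eq hΩ (x := x + s • e) (c := t - s) (e := e)
      (u := fun x => LipZero.distFun z₀ (z k) (f x)) (v := V (LipZero.distFun z₀ (z k)))
      (fun a b hab => ?_) (hs.2 k) ?_ hseg
    · have e3 : ∫ r in (0 : ℝ)..(t - s), V (LipZero.distFun z₀ (z k)) (x + s • e + r • e)
          = ∫ r in s..t, V (LipZero.distFun z₀ (z k)) (x + r • e) := by
        simp_rw [e1]
        rw [intervalIntegral.integral_comp_add_right
          (fun r => V (LipZero.distFun z₀ (z k)) (x + r • e)), zero_add, sub_add_cancel]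
      rw [e3, e1, sub_add_cancel] at key
      rw [abs_sub_comm, key, ← Real.norm_eq_abs]
      refine intervalIntegral.norm_integral_le_abs_of_norm_le ?_ (h2 s t hst)
      refine (ae_restrict_iff' measurableSet_uIoc).2 (h3.mono fun r hr hr' => ?_)
      exact hr (hst r (uIoc_subset_uIcc hr')) k
    · simp_rw [e1]
      have := (h1 k (a + s) (b + s) fun t ht => ?_).comp_add_right s
      · simpa using this
      · have h4 : t - s ∈ uIcc a b := by
          have := mem_image_of_mem (· + -s) ht
          simpa [sub_eq_add_neg] using this
        simpa [e1] using hab _ h4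
    · rw [e1, sub_add_cancel]
      exact ht.2 k

end MetricLines

/-! ### Extending a curve from a dense set of parameters -/

section OneDimExtension

theorem IsOpen.exists_Icc_subset_of_uIcc_subset {U : Set ℝ} (hU : IsOpen U) {s t : ℝ}
    (h : uIcc s t ⊆ U) : ∃ a b : ℝ, uIcc s t ⊆ Ioo a b ∧ a ≤ b ∧ Icc a b ⊆ U := by
  obtain ⟨ε, hε, hεU⟩ := isCompact_uIcc.exists_cthickening_subset_open hU h
  have h0 : min s t ≤ max s t := min_le_max
  refine ⟨min s t - ε, max s t + ε, fun r hr => ⟨?_, ?_⟩, by linarith, fun r hr => hεU ?_⟩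
  · have := hr.1; change min s t ≤ r at this; linarith
  · have := hr.2; change r ≤ max s t at this; linarith
  · refine Metric.mem_cthickening_of_dist_le r (max (min s t) (min r (max s t))) ε _ ?_ ?_
    · exact ⟨le_max_left _ _, max_le h0 (min_le_right _ _)⟩
    · rw [Real.dist_eq, abs_le]
      obtain ⟨h1, h2⟩ := hr
      rcases le_total r (max s t) with h3 | h3
      · rw [min_eq_left h3]
        rcases le_total (min s t) r with h4 | h4
        · rw [max_eq_right h4]; constructor <;> linarith
        · rw [max_eq_left h4]; constructor <;> linarith
      · rw [min_eq_right h3, max_eq_right h0]; constructor <;> linarith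

variable {U : Set ℝ} {m : ℝ → ℝ}

theorem tendsto_abs_integral_prod (hU : IsOpen U)
    (hm : ∀ a b : ℝ, uIcc a b ⊆ U → IntervalIntegrable m volume a b) {s t : ℝ}
    (h : uIcc s t ⊆ U) :
    Tendsto (fun z : ℝ × ℝ => |∫ r in z.1..z.2, m r|) (𝓝 s ×ˢ 𝓝 t) (𝓝 |∫ r in s..t, m r|) ∧
      ∀ᶠ z : ℝ × ℝ in 𝓝 s ×ˢ 𝓝 t, uIcc z.1 z.2 ⊆ U := by
  obtain ⟨a, b, hab, hle, hU'⟩ := hU.exists_Icc_subset_of_uIcc_subset h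
  have hs := hab left_mem_uIcc
  have ht := hab right_mem_uIcc
  have hev : ∀ᶠ z : ℝ × ℝ in 𝓝 s ×ˢ 𝓝 t, z.1 ∈ Ioo a b ∧ z.2 ∈ Ioo a b :=
    prod_mem_prod (Ioo_mem_nhds hs.1 hs.2) (Ioo_mem_nhds ht.1 ht.2)
  have hI := hm a b (by rwa [uIcc_of_le hle])
  have hF : ContinuousOn (fun x => ∫ r in a..x, m r) (Icc a b) := by
    rw [← uIcc_of_le hle]
    exact intervalIntegral.continuousOn_primitive_interval' hI left_mem_uIcc
  have hFat : ∀ x ∈ Ioo a b, Tendsto (fun x => ∫ r in a..x, m r) (𝓝 x) (𝓝 (∫ r in a..x, m r)) :=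
    fun x hx => (hF.continuousAt (Icc_mem_nhds hx.1 hx.2))
  have hsub : ∀ x ∈ Ioo a b, IntervalIntegrable m volume a x := fun x hx =>
    hI.mono_set (uIcc_subset_uIcc left_mem_uIcc (by
      rw [uIcc_of_le hle]; exact Ioo_subset_Icc_self hx))
  have heq : ∀ x ∈ Ioo a b, ∀ y ∈ Ioo a b,
      (∫ r in a..y, m r) - (∫ r in a..x, m r) = ∫ r in x..y, m r := fun x hx y hy =>
    intervalIntegral.integral_interval_sub_left (hsub y hy) (hsub x hx)
  refine ⟨?_, hev.mono fun z hz => ?_⟩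
  · have := (((hFat t ht).comp (tendsto_snd (f := 𝓝 s))).sub
      ((hFat s hs).comp (tendsto_fst (g := 𝓝 t)))).abs
    rw [heq s hs t ht] at this
    refine this.congr' (hev.mono fun z hz => ?_)
    exact congrArg abs (heq _ hz.1 _ hz.2)
  · exact (ordConnected_Ioo.uIcc_subset hz.1 hz.2).trans (Ioo_subset_Icc_self.trans hU')

variable {X : Type*} [PseudoMetricSpace X] {γ : ℝ → X} {S : Set ℝ}

/-- The integral of `m` between two parameters tends to `0` as both approach `s`, so `γ` is Cauchy
along `S` at `s`. -/
theorem exists_tendsto_nhdsWithin_of_dist_le [CompleteSpace X] (hU : IsOpen U)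
    (hm : ∀ a b : ℝ, uIcc a b ⊆ U → IntervalIntegrable m volume a b) (hS : U ⊆ closure S)
    (hγ : ∀ s ∈ S, ∀ t ∈ S, uIcc s t ⊆ U → dist (γ s) (γ t) ≤ |∫ r in s..t, m r|)
    {s : ℝ} (hs : s ∈ U) : ∃ y, Tendsto γ (𝓝[S] s) (𝓝 y) := by
  have : (𝓝[S] s).NeBot := mem_closure_iff_nhdsWithin_neBot.1 (hS hs)
  obtain ⟨h1, h2⟩ := tendsto_abs_integral_prod hU hm (s := s) (t := s) (by simpa)
  rw [intervalIntegral.integral_same, abs_zero] at h1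
  have hle : 𝓝[S] s ×ˢ 𝓝[S] s ≤ 𝓝 s ×ˢ 𝓝 s :=
    prod_mono nhdsWithin_le_nhds nhdsWithin_le_nhds
  refine cauchy_map_iff_exists_tendsto.1 (cauchy_map_iff.2 ⟨this, ?_⟩)
  rw [tendsto_uniformity_iff_dist_tendsto_zero]
  refine squeeze_zero' (Eventually.of_forall fun _ => dist_nonneg) ?_ (h1.mono_left hle)
  filter_upwards [h2.filter_mono hle, prod_mem_prod self_mem_nhdsWithin self_mem_nhdsWithin]
    with z hz hzS
  exact hγ _ hzS.1 _ hzS.2 hz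

theorem dist_le_of_tendsto_nhdsWithin (hU : IsOpen U)
    (hm : ∀ a b : ℝ, uIcc a b ⊆ U → IntervalIntegrable m volume a b) (hS : U ⊆ closure S)
    (hγ : ∀ s ∈ S, ∀ t ∈ S, uIcc s t ⊆ U → dist (γ s) (γ t) ≤ |∫ r in s..t, m r|)
    {s t : ℝ} (hst : uIcc s t ⊆ U) {y y' : X} (hy : Tendsto γ (𝓝[S] s) (𝓝 y))
    (hy' : Tendsto γ (𝓝[S] t) (𝓝 y')) : dist y y' ≤ |∫ r in s..t, m r| := by
  have : (𝓝[S] s).NeBot := mem_closure_iff_nhdsWithin_neBot.1 (hS (hst left_mem_uIcc))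
  have : (𝓝[S] t).NeBot := mem_closure_iff_nhdsWithin_neBot.1 (hS (hst right_mem_uIcc))
  obtain ⟨h1, h2⟩ := tendsto_abs_integral_prod hU hm hst
  have hle : 𝓝[S] s ×ˢ 𝓝[S] t ≤ 𝓝 s ×ˢ 𝓝 t :=
    prod_mono nhdsWithin_le_nhds nhdsWithin_le_nhds
  refine le_of_tendsto_of_tendsto ((hy.comp tendsto_fst).dist (hy'.comp tendsto_snd))
    (h1.mono_left hle) ?_
  filter_upwards [h2.filter_mono hle, prod_mem_prod self_mem_nhdsWithin self_mem_nhdsWithin]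
    with z hz hzS
  exact hγ _ hzS.1 _ hzS.2 hz

end OneDimExtension

/-! ### The representative that is absolutely continuous on lines -/

section Representative

variable {n : ℕ} {X : Type*} [MetricSpace X] {Ω : Set (EuclideanSpace ℝ (Fin n))}

/-- A map whose increments on almost every line, between points of a set of full measure, are
controlled by an integrable function has a representative that is absolutely continuous on almost
every line. -/
theorem exists_ae_eq_isACOnLines [CompleteSpace X] (hΩ : IsOpen Ω)
    {f : EuclideanSpace ℝ (Fin n) → X} {m : EuclideanSpace ℝ (Fin n) → ℝ} (hm : LocL1 Ω m)
    {e : EuclideanSpace ℝ (Fin n)} {G : Set (EuclideanSpace ℝ (Fin n))}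
    (hG : ∀ᵐ x ∂(volume.restrict Ω), x ∈ G)
    (hf : ∀ᵐ x, ∀ s t : ℝ, (∀ r ∈ uIcc s t, x + r • e ∈ Ω) → x + s • e ∈ G → x + t • e ∈ G →
      dist (f (x + s • e)) (f (x + t • e)) ≤ |∫ r in s..t, m (x + r • e)|) :
    ∃ f' : EuclideanSpace ℝ (Fin n) → X, f' =ᵐ[volume.restrict Ω] f ∧ IsACOnLines Ω e f' := by
  classical
  -- The value at `x` is the limit of `f` at `x` along the line through `x`, within `G`. It does not
  -- depend on the base point used to parametrise that line (`hshift`), so one definition serves all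
  -- lines.
  let f' : EuclideanSpace ℝ (Fin n) → X := fun x =>
    if h : ∃ y, Tendsto (fun r : ℝ => f (x + r • e)) (𝓝[{r : ℝ | x + r • e ∈ G}] 0) (𝓝 y)
      then h.choose else f x
  have hshift : ∀ (x : EuclideanSpace ℝ (Fin n)) (s : ℝ) (y : X),
      Tendsto (fun r : ℝ => f (x + s • e + r • e)) (𝓝[{r : ℝ | x + s • e + r • e ∈ G}] 0) (𝓝 y) ↔
        Tendsto (fun r : ℝ => f (x + r • e)) (𝓝[{r : ℝ | x + r • e ∈ G}] s) (𝓝 y) := by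
    intro x s y
    have h1 : map (s + ·) (𝓝[(s + ·) ⁻¹' {r : ℝ | x + r • e ∈ G}] 0)
        = 𝓝[{r : ℝ | x + r • e ∈ G}] (s + 0) :=
      (Homeomorph.addLeft s).isOpenEmbedding.map_nhdsWithin_preimage_eq _ _
    rw [add_zero] at h1
    rw [← h1, tendsto_map'_iff]
    have h2 : ∀ r : ℝ, x + (s + r) • e = x + s • e + r • e := fun r => by rw [add_smul]; abel
    simp only [Function.comp_def, preimage_ofPred_eq, h2]
  have hopen : ∀ x : EuclideanSpace ℝ (Fin n), IsOpen {r : ℝ | x + r • e ∈ Ω} := fun x =>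
    hΩ.preimage (by fun_prop : Continuous fun r : ℝ => x + r • e)
  have hclos : ∀ x, (∀ᵐ r : ℝ, x + r • e ∈ Ω → x + r • e ∈ G) →
      {r : ℝ | x + r • e ∈ Ω} ⊆ closure {r : ℝ | x + r • e ∈ G} := fun x hx => by
    refine ((Measure.dense_of_ae hx).open_subset_closure_inter (hopen x)).trans (closure_mono ?_)
    exact fun r hr => hr.2 hr.1
  have hlim : ∀ᵐ x, ∀ s : ℝ, x + s • e ∈ Ω →
      Tendsto (fun r : ℝ => f (x + r • e)) (𝓝[{r : ℝ | x + r • e ∈ G}] s)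
        (𝓝 (f' (x + s • e))) := by
    filter_upwards [hf, hm.ae_intervalIntegrable_line hΩ e,
      ae_ae_line_of_ae_restrict hΩ.measurableSet hG e] with x h1 h2 h3 s hs
    have hex := exists_tendsto_nhdsWithin_of_dist_le (hopen x) h2 (hclos x h3)
      (fun s hs t ht hst => h1 s t hst hs ht) hs
    rw [← hshift]
    simp_rw [← hshift x s] at hex
    simp only [f']
    rw [dif_pos hex]
    exact hex.choose_spec
  refine ⟨f', ?_, ?_⟩
  · filter_upwards [ae_restrict_of_ae hlim, hG, ae_restrict_mem hΩ.measurableSet] with x h1 h2 h3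
    have h4 := h1 0 (by simpa)
    -- At a point of `G` the approach set contains the point itself, which forces the limit to be `f
    -- x`.
    have h5 := h4.mono_left (pure_le_nhdsWithin (by simpa using h2))
    simpa using tendsto_nhds_unique h5 (tendsto_pure_nhds _ _)
  · refine ae_restrict_of_ae ?_
    filter_upwards [hf, hm.ae_intervalIntegrable_line hΩ e,
      ae_ae_line_of_ae_restrict hΩ.measurableSet hG e, hlim] with x h1 h2 h3 h4 a b hab habΩ
    rw [← uIcc_of_le hab] at habΩ
    refine AbsolutelyContinuousOnInterval.of_dist_le (h2 a b habΩ) fun s hs t ht => ?_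
    have hst := (uIcc_subset_uIcc hs ht).trans habΩ
    exact dist_le_of_tendsto_nhdsWithin (hopen x) h2 (hclos x h3)
      (fun s hs t ht hst => h1 s t hst hs ht) hst (h4 s (hst left_mem_uIcc))
      (h4 t (hst right_mem_uIcc))

end Representative

theorem AbsolutelyContinuousOnInterval.continuousOn_of_pseudoMetricSpace {X : Type*}
    [PseudoMetricSpace X] {γ : ℝ → X} {a b : ℝ} (hγ : AbsolutelyContinuousOnInterval γ a b) :
    ContinuousOn γ (uIcc a b) := by
  rw [absolutelyContinuousOnInterval_iff] at hγ
  rw [Metric.continuousOn_iff]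
  intro s hs ε hε
  obtain ⟨δ, hδ, h⟩ := hγ ε hε
  refine ⟨δ, hδ, fun t ht hts => ?_⟩
  -- Continuity is the case of a family with a single interval.
  have hmem : ((1, fun _ => (t, s)) : ℕ × (ℕ → ℝ × ℝ)) ∈
      AbsolutelyContinuousOnInterval.disjWithin a b := ⟨fun _ _ => ⟨ht, hs⟩, by simp⟩
  simpa using h _ hmem (by simpa using hts)

/-! ### The canonical derivative of a representative -/

section Canonical

variable {n : ℕ} {X : Type*} [MetricSpace X] {z₀ : X} {Ω : Set (EuclideanSpace ℝ (Fin n))}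

/-- Continuity on segments is all that is used of a given representative: the quantitative bounds
come from the weak derivatives. -/
theorem IsACOnLines.ae_continuousOn {e : EuclideanSpace ℝ (Fin n)}
    {f : EuclideanSpace ℝ (Fin n) → X} (hΩ : IsOpen Ω) (hf : IsACOnLines Ω e f) :
    ∀ᵐ x, x ∈ Ω → ∀ a b : ℝ, (∀ t ∈ uIcc a b, x + t • e ∈ Ω) →
      ContinuousOn (fun t : ℝ => f (x + t • e)) (uIcc a b) := by
  filter_upwards [(ae_restrict_iff' hΩ.measurableSet).1 hf] with x hx hxΩ a b hab
  rcases le_total a b with h | h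
  · exact (hx hxΩ a b h (by rwa [uIcc_of_le h] at hab)).continuousOn_of_pseudoMetricSpace
  · rw [uIcc_comm] at hab ⊢
    exact (hx hxΩ b a h (by rwa [uIcc_of_le h] at hab)).continuousOn_of_pseudoMetricSpace

theorem continuousOn_integral_uIcc {w : ℝ → ℝ} {h : ℝ} (hw : IntervalIntegrable w volume 0 h) :
    ContinuousOn (fun t : ℝ => ∫ r in (0 : ℝ)..t, w r) (uIcc 0 h) :=
  intervalIntegral.continuousOn_primitive_interval' hw left_mem_uIcc

theorem segDomain_of_mem {E : Type*} [AddCommGroup E] [Module ℝ E] {e x : E} {h r : ℝ} {Ω : Set E}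
    (hx : x ∈ segDomain Ω e h) (hr : r ∈ uIcc 0 h) : x ∈ segDomain Ω e r :=
  fun _ ht => hx _ (uIcc_subset_uIcc left_mem_uIcc hr ht)

theorem eventually_mem_segDomain {E : Type*} [NormedAddCommGroup E] [NormedSpace ℝ E] {Ω : Set E}
    (hΩ : IsOpen Ω) {x : E} (hx : x ∈ Ω) (e : E) : ∀ᶠ h : ℝ in 𝓝 0, x ∈ segDomain Ω e h := by
  have ho : IsOpen {h : ℝ | x ∈ segDomain Ω e h} :=
    (isOpen_setOf_mem_segDomain hΩ e).preimage (by fun_prop : Continuous fun h : ℝ => (x, h))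
  refine ho.mem_nhds fun r hr => ?_
  rw [uIcc_self, mem_singleton_iff] at hr
  simpa [hr] using hx

/-- The increments of a continuous representative on almost every line are controlled by the
speed. -/
theorem ae_dist_le_integral_of_isACOnLines (hΩ : IsOpen Ω)
    {f f' : EuclideanSpace ℝ (Fin n) → X} {m : EuclideanSpace ℝ (Fin n) → ℝ} (hm : LocL1 Ω m)
    {e : EuclideanSpace ℝ (Fin n)} {G : Set (EuclideanSpace ℝ (Fin n))}
    (hG : ∀ᵐ x ∂(volume.restrict Ω), x ∈ G)
    (hf : ∀ᵐ x, ∀ s t : ℝ, (∀ r ∈ uIcc s t, x + r • e ∈ Ω) → x + s • e ∈ G → x + t • e ∈ G →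
      dist (f (x + s • e)) (f (x + t • e)) ≤ |∫ r in s..t, m (x + r • e)|)
    (hff' : f' =ᵐ[volume.restrict Ω] f) (hac : IsACOnLines Ω e f') :
    ∀ᵐ x, x ∈ Ω → ∀ h : ℝ, x ∈ segDomain Ω e h →
      dist (f' x) (f' (x + h • e)) ≤ |∫ r in (0 : ℝ)..h, m (x + r • e)| := by
  have hgood := hff'.and hG
  filter_upwards [hf, hm.ae_intervalIntegrable_line hΩ e, hac.ae_continuousOn hΩ,
    (ae_restrict_iff' hΩ.measurableSet).1 hgood,
    ae_ae_line_of_ae_restrict hΩ.measurableSet hgood e] with x h1 h2 h3 h4 h5 hx h hh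
  rcases eq_or_ne 0 h with rfl | hne
  · simp
  -- Both sides are continuous in the step, so the bound at almost every step extends to `h` itself.
  refine le_on_uIcc_of_ae_le (f := fun t : ℝ => dist (f' x) (f' (x + t • e)))
    (g := fun t : ℝ => |∫ r in (0 : ℝ)..t, m (x + r • e)|) hne ?_
    (fun t ht => tendsto_const_nhds.dist (h3 hx 0 h hh t ht))
    (continuousOn_integral_uIcc (h2 0 h hh)).abs h right_mem_uIcc
  filter_upwards [h5] with r hr hr'
  have hxr := hr (hh r hr')
  have := h1 0 r (segDomain_of_mem hh hr') (by simpa using (h4 hx).2) hxr.2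
  rw [hxr.1, (h4 hx).1]
  simpa using this

theorem IsWeakPartialDeriv.ae_increment_eq_of_isACOnLines (hΩ : IsOpen Ω) {j : Fin n}
    {f f' : EuclideanSpace ℝ (Fin n) → X} {φ : LipZero z₀} {v : EuclideanSpace ℝ (Fin n) → ℝ}
    (hv : IsWeakPartialDeriv Ω j (fun x => φ (f x)) v)
    (hff' : f' =ᵐ[volume.restrict Ω] f)
    (hac : IsACOnLines Ω (EuclideanSpace.single j (1 : ℝ)) f') :
    ∀ᵐ x, x ∈ Ω → ∀ h : ℝ, x ∈ segDomain Ω (EuclideanSpace.single j (1 : ℝ)) h →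
      φ (f' (x + h • EuclideanSpace.single j (1 : ℝ))) - φ (f' x)
        = ∫ r in (0 : ℝ)..h, v (x + r • EuclideanSpace.single j (1 : ℝ)) := by
  set e : EuclideanSpace ℝ (Fin n) := EuclideanSpace.single j (1 : ℝ) with he
  have hv' : IsWeakPartialDeriv Ω j (fun x => φ (f' x)) v :=
    hv.congr (hff'.mono fun x hx => by simp only [hx]) (EventuallyEq.refl _ _)
  filter_upwards [hv'.ae_ae_increment_eq hΩ, hv.2.1.ae_intervalIntegrable_line hΩ e,
    hac.ae_continuousOn hΩ] with x h1 h2 h3 hx h hh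
  rcases eq_or_ne 0 h with rfl | hne
  · simp
  have hc1 : ContinuousOn (fun t : ℝ => φ (f' (x + t • e)) - φ (f' x)) (uIcc 0 h) :=
    (φ.continuous.comp_continuousOn (h3 hx 0 h hh)).sub continuousOn_const
  have hc2 := continuousOn_integral_uIcc (h2 0 h hh)
  have key : ∀ᵐ r : ℝ, r ∈ uIcc 0 h →
      φ (f' (x + r • e)) - φ (f' x) = ∫ t in (0 : ℝ)..r, v (x + t • e) :=
    h1.mono fun r hr hr' => hr (segDomain_of_mem hh hr')
  exact le_antisymm
    (le_on_uIcc_of_ae_le hne (key.mono fun r hr hr' => (hr hr').le) hc1 hc2 h right_mem_uIcc)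
    (le_on_uIcc_of_ae_le hne (key.mono fun r hr hr' => (hr hr').ge) hc2 hc1 h right_mem_uIcc)

theorem tendsto_abs_div_of_hasDerivAt {M : ℝ → ℝ} {l : ℝ} (hM : HasDerivAt M l 0)
    (h0 : M 0 = 0) : Tendsto (fun h => |M h| / |h|) (𝓝[≠] 0) (𝓝 |l|) := by
  refine (hasDerivAt_iff_tendsto_slope.1 hM).abs.congr fun h => ?_
  rw [slope_def_field, h0, sub_zero, sub_zero, abs_div]

/-- The canonical derivative of a representative that is absolutely continuous on lines is a weak
weak* derivative, and its norm is the speed almost everywhere. -/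
theorem canonicalDeriv_properties (hΩ : IsOpen Ω) {p : ℝ≥0∞} (hp : 1 ≤ p) {j : Fin n}
    {f f' : EuclideanSpace ℝ (Fin n) → X} (hfp : MemW1pMetric Ω z₀ p f)
    (hff' : f' =ᵐ[volume.restrict Ω] f)
    (hac : IsACOnLines Ω (EuclideanSpace.single j (1 : ℝ)) f') :
    (∀ᵐ x ∂(volume.restrict Ω),
      HasBoundedQuotients z₀ (EuclideanSpace.single j (1 : ℝ)) f' x) ∧
    ∀ L : lp (fun _ : ℕ => ℝ) ∞ →L[ℝ] ℝ, IsBanachLimit L →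
      ∀ (δ : ℕ → ℝ) (hδ : IsStepSequence δ),
        IsWeakWeakStarDeriv Ω z₀ j f
          (canonicalDeriv z₀ L hδ (EuclideanSpace.single j (1 : ℝ)) f') ∧
        MemLp (fun x => ‖canonicalDeriv z₀ L hδ (EuclideanSpace.single j (1 : ℝ)) f' x‖) p
          (volume.restrict Ω) := by
  set e : EuclideanSpace ℝ (Fin n) := EuclideanSpace.single j (1 : ℝ) with he
  obtain ⟨z, V, m, hz, hV, hmp, hVm, hmV⟩ := hfp.exists_speed hΩ j
  have hm := MemLp.locL1 hp hmp
  obtain ⟨G, hG, hf⟩ := exists_ae_dist_le_integral hΩ hm hz hV hVm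
  have hm0 : ∀ᵐ x ∂(volume.restrict Ω), 0 ≤ m x := hVm.mono fun x hx => (abs_nonneg _).trans (hx 0)
  have hdist : ∀ᵐ x ∂(volume.restrict Ω), ∀ᶠ h : ℝ in 𝓝 0,
      dist (f' x) (f' (x + h • e)) ≤ |∫ r in (0 : ℝ)..h, m (x + r • e)| := by
    filter_upwards [ae_restrict_of_ae (ae_dist_le_integral_of_isACOnLines hΩ hm hG hf hff' hac),
      ae_restrict_mem hΩ.measurableSet] with x h1 h2
    exact (eventually_mem_segDomain hΩ h2 e).mono fun h hh => h1 h2 h hh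
  have hlim : ∀ᵐ x ∂(volume.restrict Ω), Tendsto
      (fun h : ℝ => |∫ r in (0 : ℝ)..h, m (x + r • e)| / |h|) (𝓝[≠] 0) (𝓝 (m x)) := by
    filter_upwards [ae_restrict_of_ae (hm.ae_hasDerivAt_line hΩ e),
      ae_restrict_mem hΩ.measurableSet, hm0] with x h1 h2 h3
    have := tendsto_abs_div_of_hasDerivAt (h1 h2) intervalIntegral.integral_same
    rwa [abs_of_nonneg h3] at this
  have hbq : ∀ᵐ x ∂(volume.restrict Ω), HasBoundedQuotients z₀ e f' x := by
    filter_upwards [hdist, hlim] with x h1 h2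
    exact hasBoundedQuotients_of_dist_le h2 h1
  refine ⟨hbq, fun L hL δ hδ => ?_⟩
  -- The null set may depend on `φ`. Where the derivative along the line exists, every Banach limit
  -- of the quotients equals it.
  have hderiv : ∀ φ : LipZero z₀, ∀ᵐ x ∂(volume.restrict Ω),
      canonicalDeriv z₀ L hδ e f' x φ = V φ x := by
    intro φ
    filter_upwards [ae_restrict_of_ae ((hV φ).2.1.ae_hasDerivAt_line hΩ e),
      ae_restrict_of_ae ((hV φ).ae_increment_eq_of_isACOnLines hΩ hff' hac),
      ae_restrict_mem hΩ.measurableSet, hbq] with x h1 h2 hx h3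
    refine h3.canonicalDeriv_eq hL hδ ?_
    refine ((h1 hx).add_const (φ (f' x))).congr_of_eventuallyEq ?_
    filter_upwards [eventually_mem_segDomain hΩ hx e] with h hh
    rw [← h2 hx h hh]
    ring
  refine ⟨⟨hfp.1.locL1Metric hp, fun φ => (hV φ).congr (EventuallyEq.refl _ _)
    ((hderiv φ).mono fun x hx => hx.symm)⟩, ?_⟩
  -- The norm equals `m` almost everywhere: the increment bound gives one inequality, and the
  -- countably many functions `distFun z₀ (z k)`, of norm at most `1`, give the other. Measurability
  -- of the norm comes with this identity.
  refine (memLp_congr_ae ?_).1 hmp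
  filter_upwards [hdist, hlim, ae_all_iff.2 fun k => hderiv (LipZero.distFun z₀ (z k))]
    with x h1 h2 h3
  refine le_antisymm (hmV _ _ fun k => ?_) (norm_canonicalDeriv_le h2 h1 hL hδ)
  rw [← h3 k, ← Real.norm_eq_abs]
  exact ((canonicalDeriv z₀ L hδ e f' x).le_opNorm _).trans
    (mul_le_of_le_one_right (norm_nonneg _) (LipZero.norm_distFun_le _ _))

theorem MemW1pMetric.exists_isACOnLines [CompleteSpace X] (hΩ : IsOpen Ω) {p : ℝ≥0∞} (hp : 1 ≤ p)
    {f : EuclideanSpace ℝ (Fin n) → X} (hfp : MemW1pMetric Ω z₀ p f) (j : Fin n) :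
    ∃ f' : EuclideanSpace ℝ (Fin n) → X, f' =ᵐ[volume.restrict Ω] f ∧
      IsACOnLines Ω (EuclideanSpace.single j (1 : ℝ)) f' := by
  obtain ⟨z, V, m, hz, hV, hmp, hVm, -⟩ := hfp.exists_speed hΩ j
  have hm := MemLp.locL1 hp hmp
  obtain ⟨G, hG, hf⟩ := exists_ae_dist_le_integral hΩ hm hz hV hVm
  exact exists_ae_eq_isACOnLines hΩ hm hG hf

/-! ### Uniqueness of weak derivatives and the converse implication -/

theorem IsWeakPartialDeriv.ae_eq (hΩ : IsOpen Ω) {j : Fin n}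
    {u v v' : EuclideanSpace ℝ (Fin n) → ℝ} (hv : IsWeakPartialDeriv Ω j u v)
    (hv' : IsWeakPartialDeriv Ω j u v') : v =ᵐ[volume.restrict Ω] v' := by
  have hloc : ∀ {w : EuclideanSpace ℝ (Fin n) → ℝ}, LocL1 Ω w → LocallyIntegrableOn w Ω volume :=
    fun hw => (locallyIntegrableOn_iff hΩ.isLocallyClosed).2 fun K hKΩ hK => hw K hK hKΩ
  have hint : ∀ {η w : EuclideanSpace ℝ (Fin n) → ℝ}, IsTestFunction Ω η → LocL1 Ω w →
      ∫ x in Ω, η x * w x = ∫ x, η x • w x := fun hη _ => by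
    refine setIntegral_eq_integral_of_forall_compl_eq_zero fun x hx => ?_
    rw [image_eq_zero_of_notMem_tsupport fun h => hx (hη.2.2 h), zero_mul]
  have hi : ∀ {η w : EuclideanSpace ℝ (Fin n) → ℝ}, IsTestFunction Ω η → LocL1 Ω w →
      Integrable (fun x => η x • w x) := fun {η w} hη hw => by
    obtain ⟨C, hC⟩ := hη.2.1.exists_bound_of_continuous hη.1.continuous
    refine ((hw.integrable_indicator hη.2.1 hη.2.2).bdd_mul (c := C)
      hη.1.continuous.aestronglyMeasurable (Eventually.of_forall hC)).congr
      (Eventually.of_forall fun x => ?_)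
    by_cases hx : x ∈ tsupport η
    · simp only [indicator_of_mem hx, smul_eq_mul]
    · simp only [image_eq_zero_of_notMem_tsupport hx, zero_mul, zero_smul]
  have := hΩ.ae_eq_zero_of_integral_contDiff_smul_eq_zero
    ((hloc hv.2.1).sub (hloc hv'.2.1)) fun η h1 h2 h3 => by
      have ht : IsTestFunction Ω η := ⟨h1, h2, h3⟩
      simp_rw [Pi.sub_apply, smul_sub]
      rw [integral_sub (hi ht hv.2.1) (hi ht hv'.2.1), ← hint ht hv.2.1, ← hint ht hv'.2.1,
        sub_eq_zero, ← neg_inj, ← hv.2.2 η ht, ← hv'.2.2 η ht]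
  exact (ae_restrict_iff' hΩ.measurableSet).2 (this.mono fun x hx hxΩ => sub_eq_zero.1 (hx hxΩ))

theorem MemLpMetric.memLp_comp {p : ℝ≥0∞} {f : EuclideanSpace ℝ (Fin n) → X}
    (hf : MemLpMetric Ω z₀ p f) (φ : LipZero z₀) :
    MemLp (fun x => φ (f x)) p (volume.restrict Ω) := by
  refine (hf.2.const_mul ‖φ‖).mono (φ.continuous.comp_aestronglyMeasurable hf.1)
    (Eventually.of_forall fun x => ?_)
  have := φ.abs_sub_le (f x) z₀
  rw [φ.apply_base, sub_zero] at this
  rw [Real.norm_eq_abs]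
  exact this.trans (le_abs_self _)

/-- The Euclidean norm of a gradient is at most the sum of its components, each bounded by `‖φ‖ * ‖D
j x‖`. Uniqueness is needed because an upper gradient has to bound every choice of weak gradient. -/
theorem memW1pMetric_of_isWeakWeakStarDeriv (hΩ : IsOpen Ω) {p : ℝ≥0∞}
    {f : EuclideanSpace ℝ (Fin n) → X} (hf : MemLpMetric Ω z₀ p f)
    {D : Fin n → EuclideanSpace ℝ (Fin n) → (LipZero z₀ →L[ℝ] ℝ)}
    (hD : ∀ j : Fin n, IsWeakWeakStarDeriv Ω z₀ j f (D j) ∧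
      MemLp (fun x => ‖D j x‖) p (volume.restrict Ω)) : MemW1pMetric Ω z₀ p f := by
  refine ⟨hf, fun φ => ⟨hf.memLp_comp φ, fun j => ⟨fun x => D j x φ, (hD j).1.2 φ, ?_⟩⟩,
    fun x => ∑ j, ‖D j x‖, memLp_finsetSum _ fun j _ => (hD j).2, fun φ G hG => ?_⟩
  · refine ((hD j).2.mul_const ‖φ‖).mono (((hD j).1.2 φ).2.1.aestronglyMeasurable hΩ)
      (Eventually.of_forall fun x => ?_)
    exact ((D j x).le_opNorm φ).trans (le_abs_self _)
  · filter_upwards [ae_all_iff.2 fun j => (hG j).ae_eq hΩ ((hD j).1.2 φ)] with x hx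
    calc ‖G x‖ ≤ ∑ j, ‖G x j‖ := by
          conv_lhs => rw [← (EuclideanSpace.basisFun (Fin n) ℝ).sum_repr (G x)]
          refine (norm_sum_le _ _).trans_eq (Finset.sum_congr rfl fun j _ => ?_)
          simp [norm_smul]
      _ ≤ ∑ j, ‖φ‖ * ‖D j x‖ := Finset.sum_le_sum fun j _ => by
          rw [hx j, mul_comm]
          exact (D j x).le_opNorm φ
      _ = ‖φ‖ * ∑ j, ‖D j x‖ := (Finset.mul_sum _ _ _).symm

end Canonical

theorem mainTheorem4 {n : ℕ} {X : Type*} [MetricSpace X] [CompleteSpace X] (z₀ : X)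
    (Ω : Set (EuclideanSpace ℝ (Fin n))) (hΩ : IsOpen Ω) (p : ℝ≥0∞) (hp : 1 ≤ p) (hp_top : p ≠ ∞)
    (f : EuclideanSpace ℝ (Fin n) → X) :
    (MemW1pMetric Ω z₀ p f ↔
      MemLpMetric Ω z₀ p f ∧
        ∃ D : Fin n → EuclideanSpace ℝ (Fin n) → (LipZero z₀ →L[ℝ] ℝ),
          ∀ j : Fin n, IsWeakWeakStarDeriv Ω z₀ j f (D j) ∧
            MemLp (fun x => ‖D j x‖) p (volume.restrict Ω)) ∧
    (MemW1pMetric Ω z₀ p f → ∀ j : Fin n,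
      (∃ f' : EuclideanSpace ℝ (Fin n) → X, f' =ᵐ[volume.restrict Ω] f ∧
        IsACOnLines Ω (EuclideanSpace.single j (1 : ℝ)) f') ∧
      ∀ f' : EuclideanSpace ℝ (Fin n) → X, f' =ᵐ[volume.restrict Ω] f →
        IsACOnLines Ω (EuclideanSpace.single j (1 : ℝ)) f' →
        (∀ᵐ x ∂(volume.restrict Ω),
          HasBoundedQuotients z₀ (EuclideanSpace.single j (1 : ℝ)) f' x) ∧
        ∀ L : lp (fun _ : ℕ => ℝ) ∞ →L[ℝ] ℝ, IsBanachLimit L →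
          ∀ (δ : ℕ → ℝ) (hδ : IsStepSequence δ),
            IsWeakWeakStarDeriv Ω z₀ j f
              (canonicalDeriv z₀ L hδ (EuclideanSpace.single j (1 : ℝ)) f') ∧
            MemLp (fun x => ‖canonicalDeriv z₀ L hδ (EuclideanSpace.single j (1 : ℝ)) f' x‖) p
              (volume.restrict Ω)) := by
  have h2 : MemW1pMetric Ω z₀ p f → ∀ j : Fin n, ∃ f' : EuclideanSpace ℝ (Fin n) → X,
      f' =ᵐ[volume.restrict Ω] f ∧ IsACOnLines Ω (EuclideanSpace.single j (1 : ℝ)) f' :=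
    fun hf j => hf.exists_isACOnLines hΩ hp j
  refine ⟨⟨fun hf => ⟨hf.1, ?_⟩, fun ⟨hf, D, hD⟩ =>
    memW1pMetric_of_isWeakWeakStarDeriv hΩ hf hD⟩, fun hf j => ⟨h2 hf j, fun f' hff' hac =>
      canonicalDeriv_properties hΩ hp hf hff' hac⟩⟩
  obtain ⟨L, hL⟩ := exists_isBanachLimit
  obtain ⟨δ, hδ⟩ := exists_isStepSequence
  -- The representative may differ from one direction to another; any Banach limit and step sequence
  -- will do.
  choose F hF hFac using h2 hf
  exact ⟨fun j => canonicalDeriv z₀ L hδ (EuclideanSpace.single j (1 : ℝ)) (F j), fun j =>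
    (canonicalDeriv_properties hΩ hp hf (hF j) (hFac j)).2 L hL δ hδ⟩
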